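/- **Setting.** Let $\Gamma$ be a (finite or countably infinite) lattice with vertex set $\mathcal V$ and countable set $\mathcal L$ of oriented links $l=[v,v']$; links with a missing end vertex are allowed a priori. Each link carries a rotor space $\mathcal H_{\rm rot}=L^2(\mathrm U(1))$ with flux basis $|k\rangle$, $k\in\mathbb Z$, formal position basis $|e^{i\theta}\rangle$, electric field $\epsilon_l=\sum_k k|k\rangle\langle k|_l$ and angle shift $X_l(\lambda)=e^{-i\lambda\epsilon_l}$, $X_l(\lambda)|e^{i\theta}\rangle=|e^{i(\theta+\lambda)}\rangle$. Put $\mathcal H_{\rm kin}=\bigotimes_{l\in\mathcal L}\mathcal H_{\rm rot}=L^2(\mathrm U(1)^{\mathcal L})$ (for infinite $\mathcal L$ the tensor product relative to the zero-flux vector, i.e. $L^2$ of the product of normalised Haar measures). The Gauss constraints are $\mathcal C_v=\sum_{l\text{ out of }v}\epsilon_l-\sum_{l\text{ into }v}\epsilon_l$, and $\mathcal C_W=\sum_{v\in W}\mathcal C_v$ for $W\subseteq\mathcal V$; such possibly infinite sums are defined on finite superpositions of flux states. For a set $R$ of links, $\mathcal C_{v,R}$, $\mathcal C_{W,R}$ are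 the same expressions with only the links in $R$, acting on $\mathcal H_R=\bigotimes_{l\in R}\mathcal H_{\rm rot}$. The gauge transformations are $$G(\boldsymbol\lambda)=\prod_{v}e^{i\lambda_v\mathcal C_v}=\bigotimes_{l=[v,v']}X_l(\lambda_{v'}-\lambda_v),\qquad \mathcal G=\{G(\boldsymbol\lambda)\mid\boldsymbol\lambda\in[0,2\pi)^{\mathcal V}\}$$ (infinite products are strong limits; a missing end vertex contributes $0$ to the angle), and $G_R(\boldsymbol\lambda)$ is the same expression with only the links in $R$. A *QRF* for a group $G$ with Haar measure $dg$ acting unitarily as $U_R\otimes U_S$ on $\mathcal H_R\otimes\mathcal H_S$ is the factor $\mathcal H_R$ together with (generalised) orientation states $|\phi(g)\rangle_R$ such that $U_R(g')|\phi(g)\rangle=|\phi(g'g)\rangle$ and $\int dg\,|\phi(g)\rangle\langle\phi(g)|=c\,I_R$ for some $c>0$. It is *complete* if $U_R(g')|\phi(g)\rangle=e^{i\theta}|\phi(g)\rangle$ for some $\theta$ only when $g'=e$, and *ideal* if $\langle\phi(g)|\phi(g')\rangle=\delta(g,g')$. Generalised states are antilinear functionals on continuous test functions, unitaries act on them by duality,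 and delta-orthonormality is meant in the sense of distributions: the superpositions $\int a(g)|\phi(g)\rangle\,dg$ with $a\in L^2$ are vectors of $\mathcal H_R$, depending isometrically on $a$. **Theorem (Spanning tree QRFs).** Suppose that $\sum_{v\in\mathcal V}\mathcal C_v=0$ (this holds if every link has two end vertices, as for infinite lattices and for finite lattices with periodic or smooth boundary). Let $T$ be (the link set of) a spanning tree of $\Gamma$: a loop-free set of links connecting all vertices. Put $R=T$ and $S=\mathcal L\setminus T$. Then $R$ is a QRF for $\mathcal G$ with the following properties. 1. $\mathcal H_{\rm kin}=\mathcal H_R\otimes\mathcal H_S$, where $\mathcal H_R=\bigotimes_{l\in R}\mathcal H_{\rm rot}$ and $\mathcal H_S=\bigotimes_{l\in S}\mathcal H_{\rm rot}$, and $G(\boldsymbol\lambda)=G_R(\boldsymbol\lambda)\otimes G_S(\boldsymbol\lambda)$. 2. There are vertex sets $V_l\subseteq\mathcal V$, $l\in R$, with $\mathcal C_{V_l,R}=-\epsilon_l$ such that gauge transformations are uniquely parametrised by $\boldsymbol\lambda=(\lambda_l)_{l\in R}$ through $$G'(\boldsymbol\lambda)=\prod_{l\in R}e^{i\lambda_l\mathcal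 C_{V_l}},\qquad G'_R(\boldsymbol\lambda)=\bigotimes_{l\in R}X_l(\lambda_l):$$ $\boldsymbol\lambda\mapsto G'(\boldsymbol\lambda)$ is a bijection from $[0,2\pi)^R$ onto $\mathcal G$, it depends only on the angles modulo $2\pi$ and as such is a strongly continuous homomorphism on $\mathrm U(1)^R$. Moreover $G'(\boldsymbol\lambda)=G'_R(\boldsymbol\lambda)\otimes G'_S(\boldsymbol\lambda)$, where $G'_R$ and $G'_S$ are the products $\prod_{l\in R}e^{i\lambda_l\mathcal C_{V_l,R}}$ and $\prod_{l\in R}e^{i\lambda_l\mathcal C_{V_l,S}}$, and whenever $G'(\boldsymbol\lambda)=G(\boldsymbol\mu)$ one has $G'_R(\boldsymbol\lambda)=G_R(\boldsymbol\mu)$ and $G'_S(\boldsymbol\lambda)=G_S(\boldsymbol\mu)$. 3. The orientation states $|\phi(\boldsymbol\lambda)\rangle_R=G'_R(\boldsymbol\lambda)\bigotimes_{l\in R}|e^{i0}\rangle_l=\bigotimes_{l\in R}|e^{i\lambda_l}\rangle_l$ form a formal orthonormal basis of $\mathcal H_R$ (delta-orthonormal and complete) and satisfy $$G'_R(\boldsymbol\eta)|\phi(\boldsymbol\lambda)\rangle_R=|\phi(\boldsymbol\lambda+\boldsymbol\eta)\rangle_R,\qquad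 \langle\phi(\boldsymbol\eta)|\phi(\boldsymbol\lambda)\rangle_R=\prod_{l\in R}\delta(\eta_l-\lambda_l).$$ Here the delta functions and the position states are normalised with respect to $\prod_l d\lambda_l/2\pi$; if $R$ is finite, the states $(2\pi)^{-|R|/2}|\phi(\boldsymbol\lambda)\rangle_R$, $\boldsymbol\lambda\in[0,2\pi)^R$, are a formal orthonormal basis with respect to $\prod_l d\lambda_l$. Consequently $R$, with the representation $G'_R$ and these orientation states, is a complete ideal QRF for $\mathcal G\cong\mathrm U(1)^R$. -/

import Mathlib

open MeasureTheory Filter Topology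
open scoped TensorProduct ComplexConjugate

noncomputable section

namespace LatticeQED

/-! ### Quantum rotors -/

/-- `U(1)` in the angle coordinate, i.e. `ℝ / 2πℤ`; the angle `θ` stands for `e^{iθ}`. -/
abbrev U1 : Type := AddCircle (2 * Real.pi)

instance : Fact (0 < 2 * Real.pi) := ⟨Real.two_pi_pos⟩

/-- The product over `I` of the normalised Haar measures `dθ/2π` of `U(1)`. -/
def rotorMeasure (I : Type*) : Measure (I → U1) :=
  Measure.infinitePi fun _ : I => (AddCircle.haarAddCircle : Measure U1)

instance (I : Type*) : IsProbabilityMeasure (rotorMeasure I) := by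
  unfold rotorMeasure; infer_instance

/-- The Hilbert space of a single rotor, `L²(U(1))`. -/
abbrev Rotor : Type := Lp ℂ 2 (AddCircle.haarAddCircle : Measure U1)

/-- The Hilbert space `⨂_{i ∈ I} L²(U(1))` of rotors labelled by `I`, realised as
`L²(U(1)^I)`. For infinite `I` the tensor product is taken relative to the zero-flux vector
(the constant function `1`). -/
abbrev RotorSpace (I : Type*) : Type _ := Lp ℂ 2 (rotorMeasure I)

/-- `RotorSpace I` is the Hilbert tensor product of the spaces `L²(U(1))`: the product functions
`∏_{i ∈ s} ψ_i(x_i)`, `s` finite, define vectors whose inner products are the products of the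
inner products of the factors, and their linear span is dense. -/
def IsRotorTensorProduct (I : Type*) : Prop :=
  ∃ t : Finset I → (I → Rotor) → RotorSpace I,
    (∀ s ψ, (t s ψ : (I → U1) → ℂ) =ᵐ[rotorMeasure I] fun x => ∏ i ∈ s, ψ i (x i)) ∧
    (∀ s ψ ψ', inner ℂ (t s ψ) (t s ψ') = ∏ i ∈ s, inner ℂ (ψ i) (ψ' i)) ∧
    Dense (Submodule.span ℂ {Ψ | ∃ s ψ, t s ψ = Ψ} : Set (RotorSpace I))

/-- The Hilbert tensor product (completion of the algebraic one) of two rotor spaces. -/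
abbrev HilbertTensor (I J : Type*) : Type _ :=
  UniformSpace.Completion (RotorSpace I ⊗[ℂ] RotorSpace J)

/-- The tensor `f ⊗ g`. -/
def pureTensor {I J : Type*} (f : RotorSpace I) (g : RotorSpace J) : HilbertTensor I J :=
  ((f ⊗ₜ[ℂ] g : RotorSpace I ⊗[ℂ] RotorSpace J) :
    UniformSpace.Completion (RotorSpace I ⊗[ℂ] RotorSpace J))

/-! ### Electric flux basis and operators on it -/

/-- The wave function `x ↦ ∏_i e^{i k_i x_i}` of the flux state with fluxes `k_i`. -/
def fluxFun {I : Type*} (k : I →₀ ℤ) (x : I → U1) : ℂ :=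
  ∏ i ∈ k.support, fourier (k i) (x i)

lemma memLp_fluxFun {I : Type*} (k : I →₀ ℤ) : MemLp (fluxFun k) 2 (rotorMeasure I) := by
  refine MemLp.of_bound (C := 1) (Measurable.aestronglyMeasurable ?_) (ae_of_all _ fun x => ?_)
  · unfold fluxFun
    refine Finset.measurable_prod _ fun i _ => ?_
    exact (fourier (k i)).continuous.measurable.comp (measurable_pi_apply i)
  · unfold fluxFun
    rw [norm_prod]
    simp only [fourier_apply, Circle.norm_coe, Finset.prod_const_one, le_refl]

/-- The electric flux state `⨂_i |k_i⟩`. -/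
def fluxKet {I : Type*} (k : I →₀ ℤ) : RotorSpace I := (memLp_fluxFun k).toLp _

/-- Finite linear combinations of flux states: the common dense domain of the electric field
operators. The element `Finsupp.single k 1` is the state with fluxes `k`. -/
abbrev FluxVec (I : Type*) : Type _ := (I →₀ ℤ) →₀ ℂ

/-- The inclusion of the finite linear combinations of flux states into the Hilbert space. -/
def FluxVec.toL2 {I : Type*} : FluxVec I →ₗ[ℂ] RotorSpace I :=
  Finsupp.linearCombination ℂ fluxKet

/-- The electric field operator `ε_i = ∑_k k |k⟩⟨k|_i`. -/
def elec {I : Type*} (i : I) : Module.End ℂ (FluxVec I) :=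
  Finsupp.linearCombination ℂ fun k => Finsupp.single k (k i : ℂ)

/-- The sum `∑_j A_j` of a possibly infinite family of operators of which only finitely many are
nonzero on each flux state. -/
def opSum {I ι : Type*} (A : ι → Module.End ℂ (FluxVec I)) : Module.End ℂ (FluxVec I) :=
  Finsupp.linearCombination ℂ fun k => ∑ᶠ j, A j (Finsupp.single k 1)

/-- The unitary `U` is `e^{iA}`: the exponential series converges to `U` on the flux states. -/
def IsExp {I : Type*} (A : Module.End ℂ (FluxVec I)) (U : RotorSpace I ≃ₗᵢ[ℂ] RotorSpace I) :
    Prop :=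
  ∀ f : FluxVec I,
    HasSum (fun n : ℕ => (Complex.I ^ n / (n.factorial : ℂ)) • FluxVec.toL2 ((A ^ n) f))
      (U (FluxVec.toL2 f))

/-- The unitary `U` is the product `∏_j e^{iA_j}` of commuting exponentials (for infinitely many
factors, the strong limit of the finite products). -/
def IsExpProd {I ι : Type*} (A : ι → Module.End ℂ (FluxVec I))
    (U : RotorSpace I ≃ₗᵢ[ℂ] RotorSpace I) : Prop :=
  ∃ (E : ι → (RotorSpace I ≃ₗᵢ[ℂ] RotorSpace I)) (hE : ∀ j j', Commute (E j) (E j')),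
    (∀ j, IsExp (A j) (E j)) ∧
    ∀ ψ : RotorSpace I,
      Tendsto (fun s : Finset ι => (s.noncommProd E fun j _ j' _ _ => hE j j') ψ) atTop (𝓝 (U ψ))

/-! ### Angle shifts -/

lemma measurePreserving_sub {I : Type*} (a : I → U1) :
    MeasurePreserving (fun x : I → U1 => x - a) (rotorMeasure I) (rotorMeasure I) := by
  refine ⟨measurable_pi_lambda _ fun i =>
    (measurable_id.sub_const (a i)).comp (measurable_pi_apply (X := fun _ : I => U1) i), ?_⟩
  have h := Measure.infinitePi_map_pi (fun _ : I => (AddCircle.haarAddCircle : Measure U1))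
    (f := fun i (x : U1) => x - a i) (fun i => measurable_id.sub_const (a i))
  have h2 : ∀ i, Measure.map (fun x : U1 => x - a i) AddCircle.haarAddCircle
      = (AddCircle.haarAddCircle : Measure U1) := fun i =>
    (measurePreserving_sub_right _ (a i)).map_eq
  simp only [h2] at h
  exact h

/-- Translation by `a`: `(shift a ψ)(x) = ψ(x - a)`. -/
def shift {I : Type*} (a : I → U1) : RotorSpace I ≃ₗᵢ[ℂ] RotorSpace I :=
  LinearIsometryEquiv.ofSurjective
    (Lp.compMeasurePreservingₗᵢ ℂ (fun x : I → U1 => x - a) (measurePreserving_sub a)) (by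
      intro ψ
      refine ⟨Lp.compMeasurePreserving (fun x : I → U1 => x - (-a)) (measurePreserving_sub (-a)) ψ,
        ?_⟩
      change Lp.compMeasurePreserving _ (measurePreserving_sub a) _ = ψ
      rw [← Lp.compMeasurePreserving_comp_apply]
      have : (fun x : I → U1 => x - (-a)) ∘ (fun x : I → U1 => x - a) = id := by
        funext x; simp
      simp only [this]
      exact Lp.compMeasurePreserving_id_apply ψ)

/-- The angles `λ_i ∈ ℝ` modulo `2π`. -/
def ang {I : Type*} (lam : I → ℝ) : I → U1 := fun i => (lam i : U1)

/-- `⨂_i X_i(λ_i)`, where `X(λ) = e^{-iλε}` shifts the angle by `λ`. -/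
def tensorX {I : Type*} (lam : I → ℝ) : RotorSpace I ≃ₗᵢ[ℂ] RotorSpace I := shift (ang lam)

/-! ### Lattices, Gauss constraints and gauge transformations -/

/-- A lattice with vertex set `V` and link set `L`. A link `l = [v, v']` is directed from
`src l = some v` to `tgt l = some v'`; the value `none` is an end without a vertex, as for the
dangling links of a rough boundary. -/
structure LinkLattice (V L : Type*) where
  src : L → Option V
  tgt : L → Option V

namespace LinkLattice

variable {V L : Type*} (Γ : LinkLattice V L)

/-- The links in `R`, with the same vertices. -/
def restrict (R : Set L) : LinkLattice V R := ⟨fun l => Γ.src l, fun l => Γ.tgt l⟩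

/-- The pure-gauge constraint `C_v`: the sum of `ε_l` over the links `l` going out of `v` minus the
sum over the links going into `v`. For `Γ.restrict R` this is `C_{v,R}`. -/
def gauss (v : V) : Module.End ℂ (FluxVec L) :=
  opSum (fun l : {l : L // Γ.src l = some v} => elec l.1) -
    opSum (fun l : {l : L // Γ.tgt l = some v} => elec l.1)

/-- `C_W = ∑_{v ∈ W} C_v`. For `Γ.restrict R` this is `C_{W,R}`. -/
def gaussSum (W : Set V) : Module.End ℂ (FluxVec L) := opSum fun v : W => Γ.gauss v.1

/-- The gauge transformation `G(λ) = ∏_v e^{iλ_v C_v} = ⨂_{l = [v,v']} X_l(λ_{v'} - λ_v)`, where a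
missing end of a link contributes `0`. For `Γ.restrict R` this is `G_R(λ)`. -/
def gauge (lam : V → ℝ) : RotorSpace L ≃ₗᵢ[ℂ] RotorSpace L :=
  tensorX fun l => (Γ.tgt l).elim 0 lam - (Γ.src l).elim 0 lam

/-- The group `𝒢 = {G(λ) | λ ∈ [0, 2π)^V}` of gauge transformations. -/
def gaugeGroup : Set (RotorSpace L ≃ₗᵢ[ℂ] RotorSpace L) :=
  Γ.gauge '' {lam | ∀ v, lam v ∈ Set.Ico 0 (2 * Real.pi)}

/-- The graph on all of `V` whose edges are the links in `T`, with directions forgotten. -/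
def linkGraph (T : Set L) : SimpleGraph V :=
  SimpleGraph.fromRel fun v w => ∃ l ∈ T, Γ.src l = some v ∧ Γ.tgt l = some w

/-- The links in `T` join pairs of distinct vertices, distinct links join distinct pairs (so there
are no loops of one or two links), and they form a tree containing all vertices. -/
structure IsSpanningTree (T : Set L) : Prop where
  ends : ∀ l ∈ T, ∃ v w, v ≠ w ∧ Γ.src l = some v ∧ Γ.tgt l = some w
  simple : ∀ l ∈ T, ∀ l' ∈ T,
    (Γ.src l = Γ.src l' ∧ Γ.tgt l = Γ.tgt l') ∨ (Γ.src l = Γ.tgt l' ∧ Γ.tgt l = Γ.src l') → l = l'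
  tree : (Γ.linkGraph T).IsTree

end LinkLattice

/-! ### Generalised states -/

/-- Generalised states over the compact space `X`: the kets `Ψ` given by the antilinear functional
`f ↦ ⟨f|Ψ⟩` on continuous test functions. -/
abbrev GenState (X : Type*) [TopologicalSpace X] [CompactSpace X] : Type _ := C(X, ℂ) →L⋆[ℂ] ℂ

/-- The position state at `x`, with `⟨f|x⟩ = conj (f x)`. With respect to the normalised Haar
measure, this is the state `|e^{iθ}⟩` for `X = U(1)` and `x = θ`, and the state
`⨂_i |e^{iθ_i}⟩` for `X = U(1)^I` and `x = (θ_i)`. -/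
def posKet {X : Type*} [TopologicalSpace X] [CompactSpace X] (x : X) : GenState X :=
  ((starL ℂ : ℂ ≃L⋆[ℂ] ℂ) : ℂ →L⋆[ℂ] ℂ).comp (ContinuousMap.evalCLM ℂ x)

/-- `Ψ = ⨂_i ψ_i`, tested on products of finitely many one-variable functions. -/
def IsTensorState {I : Type*} (ψ : I → GenState U1) (Ψ : GenState (I → U1)) : Prop :=
  ∀ (s : Finset I) (f : I → C(U1, ℂ)), (∀ i ∉ s, f i = 1) →
    Ψ (∏ i ∈ s, (f i).comp ⟨fun x : I → U1 => x i, continuous_apply i⟩) = ∏ᶠ i, ψ i (f i)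

section
variable {I : Type*} [Countable I]

/-- A test function as a vector of the Hilbert space. -/
def testVec (f : C(I → U1, ℂ)) : RotorSpace I := ContinuousMap.toLp 2 (rotorMeasure I) ℂ f

/-- `U` preserves the test functions, and its extension to generalised states by duality,
`⟨f|UΨ⟩ = ⟨U†f|Ψ⟩`, maps `Ψ` to `Ψ'`. -/
def Applies (U : RotorSpace I ≃ₗᵢ[ℂ] RotorSpace I) (Ψ Ψ' : GenState (I → U1)) : Prop :=
  ∀ f : C(I → U1, ℂ), ∃ f' : C(I → U1, ℂ),
    testVec f' = U.symm (testVec f) ∧ Ψ' f = Ψ f'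

/-- `⟨φ(g)|φ(g')⟩ = δ(g, g')` with respect to `ν`, in the sense of distributions: the
superpositions `∫ a(g) |φ(g)⟩ dν` with `a ∈ L²(ν)` are vectors of the Hilbert space, and the inner
product of two of them is `∫ conj a(g) b(g) dν`. -/
def DeltaOrthonormal {Λ : Type*} [MeasurableSpace Λ] (ν : Measure Λ)
    (φ : Λ → GenState (I → U1)) : Prop :=
  ∃ W : Lp ℂ 2 ν →ₗᵢ[ℂ] RotorSpace I, ∀ a f,
    Integrable (fun g => a g * φ g f) ν ∧ inner ℂ (testVec f) (W a) = ∫ g, a g * φ g f ∂ν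

/-- The states `φ(g)` are a formal orthonormal basis: they are delta-orthonormal with respect to
`ν`, and every vector of the Hilbert space is a superposition of them. -/
def FormalOrthonormalBasis {Λ : Type*} [MeasurableSpace Λ] (ν : Measure Λ)
    (φ : Λ → GenState (I → U1)) : Prop :=
  ∃ W : Lp ℂ 2 ν ≃ₗᵢ[ℂ] RotorSpace I, ∀ a f,
    Integrable (fun g => a g * φ g f) ν ∧ inner ℂ (testVec f) (W a) = ∫ g, a g * φ g f ∂ν

/-! ### Quantum reference frames -/

/-- `RotorSpace I`, with the representation `U` of the (additively written) group `K` with Haar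
measure `μ` and with the orientation states `φ`, is a quantum reference frame: the orientation
states transform covariantly and resolve the identity. -/
structure IsQRF {K : Type*} [AddCommGroup K] [TopologicalSpace K] [MeasurableSpace K]
    (μ : Measure K) (U : K → (RotorSpace I ≃ₗᵢ[ℂ] RotorSpace I))
    (φ : K → GenState (I → U1)) : Prop where
  haar : μ.IsAddHaarMeasure
  map_zero : U 0 = 1
  map_add : ∀ g h, U (g + h) = U g * U h
  strongly_continuous : ∀ ψ, Continuous fun g => U g ψ
  covariant : ∀ g' g, Applies (U g') (φ g) (φ (g' + g))
  resolution : ∃ c : ℝ, 0 < c ∧ ∀ f f',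
    Integrable (fun g => φ g f * conj (φ g f')) μ ∧
      ∫ g, φ g f * conj (φ g f') ∂μ = c * inner ℂ (testVec f) (testVec f')

/-- The frame is complete: only the neutral element maps an orientation state to itself up to a
phase. -/
def IsCompleteFrame {K : Type*} [AddCommGroup K]
    (U : K → (RotorSpace I ≃ₗᵢ[ℂ] RotorSpace I)) (φ : K → GenState (I → U1)) : Prop :=
  ∀ g' g, (∃ θ : ℝ, Applies (U g') (φ g) (Complex.exp (θ * Complex.I) • φ g)) ↔ g' = 0

/-- The frame is ideal: a quantum reference frame with `⟨φ(g)|φ(g')⟩ = δ(g, g')`. -/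
def IsIdealQRF {K : Type*} [AddCommGroup K] [TopologicalSpace K] [MeasurableSpace K]
    (μ : Measure K) (U : K → (RotorSpace I ≃ₗᵢ[ℂ] RotorSpace I))
    (φ : K → GenState (I → U1)) : Prop :=
  IsQRF μ U φ ∧ DeltaOrthonormal μ φ

end

end LatticeQED

end

noncomputable section

namespace LatticeQED

/-! ### Flux states -/

/-! Every operator in the theorem is diagonal in the flux basis. If `A` acts as `∑ d_i ε_i`, the
exponential series on a flux state is a scalar one, and `e^{iA}` is the translation of `L²(U(1)^I)`
by `-d` (`IsDiag.isExp`). Translations form a faithful, strongly continuous representation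
(`shift_add`, `shift_injective`, `continuous_shift_apply`), so statements about gauge
transformations become statements about families of angles on links: `G(μ)` is the translation by
the coboundary `linkAngle μ`.

The rest of the gauge part is combinatorics of the tree. Deleting `e` from `T` cuts the tree in two;
`V_e` is the side containing the target of `e`. No other tree link crosses this cut, hence
`C_{V_e,R} = -ε_e` (`coeff_cut`). Two vertices are joined by a finite tree path, and only the cuts
of links on that path separate them; therefore an arbitrary two-ended link is affected by finitely
many `C_{V_e}` and the infinite products converge (`finite_cut`, `isExpProd_shift`). Summing a
coboundary along tree paths recovers it from its values on `T` (`finsum_cut`), and arbitrary values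
on `T` integrate to a potential (`exists_linkAngle_eq_treeAngle`). This gives the bijection with
`𝒢`. The hypothesis on the constraints enters only by excluding links with exactly one end.

The factorisation into `R` and `S` comes from Fubini's theorem and the density of flux states. On
`R` the representation is plain translation of `U(1)^R` and the orientation states are the position
states. A superposition of these with amplitude `a` is the wave function `a` itself, which yields
orthonormality, completeness and the resolution of the identity. -/

lemma fluxFun_eq_prod {I : Type*} {k : I →₀ ℤ} {s : Finset I} (h : k.support ⊆ s) (x : I → U1) :
    fluxFun k x = ∏ i ∈ s, fourier (k i) (x i) :=
  Finset.prod_subset h fun i _ hi => by simp [Finsupp.notMem_support_iff.mp hi]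

lemma fluxFun_add {I : Type*} (k k' : I →₀ ℤ) (x : I → U1) :
    fluxFun (k + k') x = fluxFun k x * fluxFun k' x := by
  classical
  rw [fluxFun_eq_prod (s := k.support ∪ k'.support) Finsupp.support_add,
    fluxFun_eq_prod (k := k) Finset.subset_union_left,
    fluxFun_eq_prod (k := k') Finset.subset_union_right, ← Finset.prod_mul_distrib]
  exact Finset.prod_congr rfl fun i _ => by rw [Finsupp.add_apply, fourier_add]

lemma fluxFun_neg {I : Type*} (k : I →₀ ℤ) (x : I → U1) :
    fluxFun (-k) x = conj (fluxFun k x) := by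
  rw [fluxFun, fluxFun, Finsupp.support_neg, map_prod]
  exact Finset.prod_congr rfl fun i _ => by rw [Finsupp.neg_apply, fourier_neg]

@[simp] lemma fluxFun_zero {I : Type*} (x : I → U1) : fluxFun (0 : I →₀ ℤ) x = 1 := by
  simp [fluxFun]

lemma fluxFun_single_one {I : Type*} (i : I) (x : I → U1) :
    fluxFun (Finsupp.single i 1) x = AddCircle.toCircle (x i) := by
  classical
  rw [fluxFun_eq_prod (s := {i}) Finsupp.support_single_subset]
  simp

lemma fluxFun_apply_add {I : Type*} (k : I →₀ ℤ) (x y : I → U1) :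
    fluxFun k (x + y) = fluxFun k x * fluxFun k y := by
  rw [fluxFun, fluxFun, fluxFun, ← Finset.prod_mul_distrib]
  refine Finset.prod_congr rfl fun i _ => ?_
  simp [fourier_apply, smul_add, AddCircle.toCircle_add]

lemma norm_fluxFun {I : Type*} (k : I →₀ ℤ) (x : I → U1) : ‖fluxFun k x‖ = 1 := by
  rw [fluxFun, norm_prod]
  simp only [fourier_apply, Circle.norm_coe, Finset.prod_const_one]

lemma continuous_fluxFun {I : Type*} (k : I →₀ ℤ) : Continuous (fluxFun k) := by
  unfold fluxFun
  fun_prop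

/-- The wave function of a flux state as a continuous function. -/
def fluxMap {I : Type*} (k : I →₀ ℤ) : C(I → U1, ℂ) := ⟨fluxFun k, continuous_fluxFun k⟩

/-- Stone–Weierstrass: the characters are closed under products and conjugation, and the characters
of single links separate points. -/
lemma span_fluxMap_closure (I : Type*) :
    (Submodule.span ℂ (Set.range (fluxMap (I := I)))).topologicalClosure = ⊤ := by
  let M : Submonoid C(I → U1, ℂ) :=
    { carrier := Set.range fluxMap
      one_mem' := ⟨0, by ext x; simp [fluxMap]⟩
      mul_mem' := by
        rintro _ _ ⟨k, rfl⟩ ⟨k', rfl⟩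
        exact ⟨k + k', by ext x; simp [fluxMap, fluxFun_add]⟩ }
  let S : StarSubalgebra ℂ C(I → U1, ℂ) :=
    { toSubalgebra := Algebra.adjoin ℂ (Set.range fluxMap)
      star_mem' := by
        change Algebra.adjoin ℂ (Set.range fluxMap) ≤ star (Algebra.adjoin ℂ (Set.range fluxMap))
        refine Algebra.adjoin_le ?_
        rintro _ ⟨k, rfl⟩
        refine Algebra.subset_adjoin ⟨-k, ?_⟩
        ext x
        simp [fluxMap, fluxFun_neg] }
  -- The characters already form a monoid, so the algebra they generate is just their span.
  have hS : S.toSubalgebra.toSubmodule = Submodule.span ℂ (Set.range fluxMap) := by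
    change (Algebra.adjoin ℂ (Set.range fluxMap)).toSubmodule = _
    rw [Algebra.adjoin_eq_span]
    congr 1
    exact congrArg SetLike.coe (Submonoid.closure_eq M)
  have hsep : S.SeparatesPoints := by
    intro x y hxy
    obtain ⟨i, hi⟩ := Function.ne_iff.mp hxy
    refine ⟨fluxFun (Finsupp.single i 1),
      ⟨fluxMap (Finsupp.single i 1), Algebra.subset_adjoin ⟨_, rfl⟩, rfl⟩, ?_⟩
    rw [fluxFun_single_one, fluxFun_single_one, Ne, Circle.coe_inj]
    contrapose hi
    exact AddCircle.injective_toCircle Real.two_pi_pos.ne' hi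
  rw [← hS]
  exact congrArg (fun A : StarSubalgebra ℂ C(I → U1, ℂ) => A.toSubalgebra.toSubmodule)
    (ContinuousMap.starSubalgebra_topologicalClosure_eq_top_of_separatesPoints S hsep)

lemma testVec_fluxMap {I : Type*} [Countable I] (k : I →₀ ℤ) : testVec (fluxMap k) = fluxKet k := by
  refine Lp.ext ?_
  filter_upwards [ContinuousMap.coeFn_toLp (p := 2) (𝕜 := ℂ) (rotorMeasure I) (fluxMap k),
    MemLp.coeFn_toLp (memLp_fluxFun k)] with x h1 h2
  exact h1.trans h2.symm

lemma dense_span_fluxKet (I : Type*) [Countable I] :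
    Dense (Submodule.span ℂ (Set.range (fluxKet (I := I))) : Set (RotorSpace I)) := by
  have h1 : DenseRange (ContinuousMap.toLp (E := ℂ) 2 (rotorMeasure I) ℂ) :=
    ContinuousMap.toLp_denseRange ℂ (rotorMeasure I) ℂ (by norm_num)
  have h2 : Dense (Submodule.span ℂ (Set.range (fluxMap (I := I))) : Set C(I → U1, ℂ)) :=
    Submodule.dense_iff_topologicalClosure_eq_top.mpr (span_fluxMap_closure I)
  have h3 := h1.dense_image (ContinuousMap.toLp (E := ℂ) 2 (rotorMeasure I) ℂ).continuous h2
  refine h3.mono ?_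
  rintro _ ⟨f, hf, rfl⟩
  have h4 := Submodule.apply_mem_span_image_of_mem_span
    (ContinuousMap.toLp (E := ℂ) 2 (rotorMeasure I) ℂ).toLinearMap hf
  refine Submodule.span_mono ?_ h4
  rintro _ ⟨_, ⟨k, rfl⟩, rfl⟩
  exact ⟨k, (testVec_fluxMap k).symm⟩

lemma fluxKet_ne_zero {I : Type*} (k : I →₀ ℤ) : fluxKet k ≠ 0 := by
  intro h
  have h1 : fluxFun k =ᵐ[rotorMeasure I] 0 :=
    (MemLp.coeFn_toLp (memLp_fluxFun k)).symm.trans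
      ((Lp.ext_iff.mp h).trans (Lp.coeFn_zero _ _ _))
  obtain ⟨x, hx⟩ := h1.exists
  have := norm_fluxFun k x
  rw [hx] at this
  simp at this

/-! ### Angle shifts -/

lemma coeFn_shift {I : Type*} (a : I → U1) (ψ : RotorSpace I) :
    (shift a ψ : (I → U1) → ℂ) =ᵐ[rotorMeasure I] fun x => ψ (x - a) :=
  Lp.coeFn_compMeasurePreserving ψ (measurePreserving_sub a)

lemma shift_zero {I : Type*} : shift (0 : I → U1) = 1 := by
  ext1 ψ
  refine Lp.ext ((coeFn_shift 0 ψ).trans (ae_of_all _ fun x => ?_))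
  simp

lemma shift_add {I : Type*} (a b : I → U1) : shift (a + b) = shift a * shift b := by
  ext1 ψ
  refine Lp.ext ?_
  have h := (measurePreserving_sub a).quasiMeasurePreserving.ae_eq_comp (coeFn_shift b ψ)
  filter_upwards [coeFn_shift (a + b) ψ, coeFn_shift a (shift b ψ), h] with x h1 h2 h3
  rw [h1]
  refine Eq.trans ?_ (h2.trans h3).symm
  simp [sub_sub]

lemma shift_neg {I : Type*} (a : I → U1) : shift (-a) = (shift a).symm := by
  have h : shift (-a) * shift a = 1 := by rw [← shift_add, neg_add_cancel, shift_zero]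
  exact eq_inv_of_mul_eq_one_left h

lemma shift_fluxKet {I : Type*} (a : I → U1) (k : I →₀ ℤ) :
    shift a (fluxKet k) = fluxFun k (-a) • fluxKet k := by
  refine Lp.ext ?_
  have h0 := MemLp.coeFn_toLp (memLp_fluxFun k)
  have h := (measurePreserving_sub a).quasiMeasurePreserving.ae_eq_comp h0
  filter_upwards [coeFn_shift a (fluxKet k), h, h0,
    Lp.coeFn_smul (fluxFun k (-a)) (fluxKet k)] with x h1 h2 h3 h4
  rw [h1, h4, Pi.smul_apply]
  refine h2.trans ?_
  rw [Function.comp_apply, sub_eq_add_neg, fluxFun_apply_add, smul_eq_mul, mul_comm]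
  exact congrArg _ h3.symm

/-- The eigenvalue on the state with one unit of flux at `i` determines the angle at `i`. -/
lemma shift_injective (I : Type*) : Function.Injective (shift (I := I)) := by
  intro a b h
  funext i
  have h1 : fluxFun (Finsupp.single i 1) (-a) = fluxFun (Finsupp.single i 1) (-b) := by
    apply smul_left_injective ℂ (fluxKet_ne_zero (Finsupp.single i 1))
    simp only [← shift_fluxKet, h]
  rw [fluxFun_single_one, fluxFun_single_one, Circle.coe_inj] at h1
  exact neg_injective (AddCircle.injective_toCircle Real.two_pi_pos.ne' h1)

/-- On flux states only a continuous phase varies. Since all translations are isometries,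
approximating `ψ` by flux superpositions approximates its orbit map uniformly. -/
lemma continuous_shift_apply {I : Type*} [Countable I] (ψ : RotorSpace I) :
    Continuous fun a => shift a ψ := by
  have hspan : ∀ χ ∈ Submodule.span ℂ (Set.range (fluxKet (I := I))),
      Continuous fun a => shift a χ := by
    intro χ hχ
    induction hχ using Submodule.span_induction with
    | mem x hx =>
      obtain ⟨k, rfl⟩ := hx
      simp only [shift_fluxKet]
      exact ((continuous_fluxFun k).comp continuous_neg).smul continuous_const
    | zero => simpa using continuous_const
    | add x y _ _ hx hy => simpa only [map_add] using hx.fun_add hy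
    | smul c x _ hx => simpa only [map_smul] using hx.fun_const_smul c
  refine continuous_of_uniform_approx_of_continuous fun u hu => ?_
  obtain ⟨ε, hε, hu⟩ := Metric.mem_uniformity_dist.mp hu
  obtain ⟨χ, hχ, hd⟩ := (dense_span_fluxKet I).exists_dist_lt ψ hε
  exact ⟨fun a => shift a χ, hspan χ hχ, fun a => hu (by rwa [LinearIsometryEquiv.dist_map])⟩

lemma noncommProd_shift {I ι : Type*} (b : ι → I → U1) (s : Finset ι)
    (h : (s : Set ι).Pairwise (Function.onFun Commute fun j => shift (b j))) :
    s.noncommProd (fun j => shift (b j)) h = shift (∑ j ∈ s, b j) := by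
  classical
  induction s using Finset.induction_on with
  | empty => simp [shift_zero]
  | insert j s hj ih =>
    rw [Finset.noncommProd_insert_of_notMem _ _ _ _ hj, ih, Finset.sum_insert hj, shift_add]

/-! ### Exponentials of diagonal operators -/

lemma FluxVec.end_ext {I : Type*} {A B : Module.End ℂ (FluxVec I)}
    (h : ∀ k, A (Finsupp.single k 1) = B (Finsupp.single k 1)) : A = B :=
  Finsupp.lhom_ext' fun k => LinearMap.ext_ring (h k)

lemma FluxVec.toL2_single {I : Type*} (k : I →₀ ℤ) (c : ℂ) :
    FluxVec.toL2 (Finsupp.single k c) = c • fluxKet k := by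
  simp [FluxVec.toL2]

/-- `A` acts on the flux states as `∑_i d_i ε_i`. -/
def IsDiag {I : Type*} (A : Module.End ℂ (FluxVec I)) (d : I → ℝ) : Prop :=
  ∀ k, A (Finsupp.single k 1) = Finsupp.single k (∑ i ∈ k.support, (k i : ℂ) * (d i : ℂ))

lemma IsDiag.ext {I : Type*} {A B : Module.End ℂ (FluxVec I)} {d : I → ℝ} (hA : IsDiag A d)
    (hB : IsDiag B d) : A = B :=
  FluxVec.end_ext fun k => (hA k).trans (hB k).symm

lemma IsDiag.smul {I : Type*} {A : Module.End ℂ (FluxVec I)} {d : I → ℝ} (hA : IsDiag A d)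
    (r : ℝ) : IsDiag ((r : ℂ) • A) (fun i => r * d i) := by
  intro k
  rw [LinearMap.smul_apply, hA k, Finsupp.smul_single, smul_eq_mul, Finset.mul_sum]
  congr 1
  refine Finset.sum_congr rfl fun i _ => ?_
  push_cast
  ring

lemma IsDiag.neg {I : Type*} {A : Module.End ℂ (FluxVec I)} {d : I → ℝ} (hA : IsDiag A d) :
    IsDiag (-A) (fun i => -d i) := by
  intro k
  rw [LinearMap.neg_apply, hA k, ← Finsupp.single_neg]
  simp

lemma fluxFun_ang {I : Type*} (k : I →₀ ℤ) (d : I → ℝ) :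
    fluxFun k (ang d) = Complex.exp (Complex.I * ∑ i ∈ k.support, (k i : ℂ) * (d i : ℂ)) := by
  rw [fluxFun, Finset.mul_sum, Complex.exp_sum]
  refine Finset.prod_congr rfl fun i _ => ?_
  rw [ang, fourier_coe_apply]
  congr 1
  have : (Real.pi : ℂ) ≠ 0 := by exact_mod_cast Real.pi_ne_zero
  push_cast
  field_simp

/-- A flux state is an eigenvector, so the series is that of a complex number. The minus sign
reflects `X(λ) = e^{-iλε}`. -/
lemma IsDiag.isExp {I : Type*} {A : Module.End ℂ (FluxVec I)} {d : I → ℝ} (hA : IsDiag A d) :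
    IsExp A (shift (-ang d)) := by
  intro f
  induction f using Finsupp.induction_linear with
  | zero => simp
  | add f g hf hg => simpa only [map_add, smul_add] using hf.add hg
  | single k c =>
    set z : ℂ := ∑ i ∈ k.support, (k i : ℂ) * (d i : ℂ) with hz
    have hsingle : ∀ c : ℂ, A (Finsupp.single k c) = Finsupp.single k (z * c) := by
      intro c
      have : (Finsupp.single k c : FluxVec I) = c • Finsupp.single k 1 := by simp
      rw [this, map_smul, hA k, Finsupp.smul_single, smul_eq_mul, mul_comm]
    have hpow : ∀ n : ℕ, (A ^ n) (Finsupp.single k c) = Finsupp.single k (z ^ n * c) := by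
      intro n
      induction n with
      | zero => simp
      | succ n ih => rw [pow_succ', Module.End.mul_apply, ih, hsingle, pow_succ', mul_assoc]
    have h1 : HasSum (fun n : ℕ => (Complex.I * z) ^ n / (n.factorial : ℂ))
        (Complex.exp (Complex.I * z)) := by
      rw [Complex.exp_eq_exp_ℂ]
      exact NormedSpace.expSeries_div_hasSum_exp (Complex.I * z)
    have h2 := h1.smul_const (c • fluxKet k)
    rw [FluxVec.toL2_single, map_smul, shift_fluxKet, neg_neg, fluxFun_ang, ← hz, smul_comm]
    refine h2.congr_fun ?_
    intro n
    rw [hpow, FluxVec.toL2_single, smul_smul, smul_smul, mul_pow]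
    congr 1
    ring

/-- A finite partial product is the translation by a partial sum of angles. By `hd` each coordinate
of that sum is eventually constant, so the sums converge in the product topology, and strong
continuity carries this over to the operators. -/
lemma isExpProd_shift {I ι : Type*} [Countable I] {A : ι → Module.End ℂ (FluxVec I)}
    {d : ι → I → ℝ} (hA : ∀ j, IsDiag (A j) (d j)) (hd : ∀ i, {j | d j i ≠ 0}.Finite) :
    IsExpProd A (shift fun i => -∑ᶠ j, (d j i : U1)) := by
  refine ⟨fun j => shift (-ang (d j)), fun j j' => ?_, fun j => (hA j).isExp, fun ψ => ?_⟩
  · rw [Commute, SemiconjBy, ← shift_add, ← shift_add, add_comm]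
  · refine Tendsto.congr (fun s => congrArg (fun U : RotorSpace I ≃ₗᵢ[ℂ] RotorSpace I => U ψ)
      (noncommProd_shift (fun j => -ang (d j)) s _).symm) ?_
    refine ((continuous_shift_apply ψ).tendsto _).comp (tendsto_pi_nhds.mpr fun i => ?_)
    refine tendsto_const_nhds.congr' ?_
    filter_upwards [eventually_ge_atTop (hd i).toFinset] with s hs
    rw [finsum_eq_sum_of_support_subset (s := s), Finset.sum_apply]
    · simp [ang]
    · intro j hj
      refine hs ((Set.Finite.mem_toFinset _).mpr fun h0 => hj ?_)
      simp [h0]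

/-! ### Eigenvalues of the constraints -/

lemma elec_single {I : Type*} (i : I) (k : I →₀ ℤ) :
    elec i (Finsupp.single k 1) = Finsupp.single k (k i : ℂ) := by
  simp [elec]

lemma opSum_single {I ι : Type*} (A : ι → Module.End ℂ (FluxVec I)) (k : I →₀ ℤ) :
    opSum A (Finsupp.single k 1) = ∑ᶠ j, A j (Finsupp.single k 1) := by
  simp [opSum]

lemma isDiag_elec {I : Type*} [DecidableEq I] (i : I) : IsDiag (elec i) (Pi.single i 1) := by
  intro k
  rw [elec_single]
  congr 1
  rw [Finset.sum_eq_single i]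
  · simp
  · intro j _ hj
    simp [hj]
  · intro hi
    simp [Finsupp.notMem_support_iff.mp hi]

namespace LinkLattice

open Classical in
/-- The indicator of a set of vertices, at an end of a link; it vanishes at a missing end. -/
def ind {V : Type*} (W : Set V) (o : Option V) : ℤ := if ∃ v ∈ W, o = some v then 1 else 0

@[simp] lemma ind_none {V : Type*} (W : Set V) : ind W none = 0 := by simp [ind]

lemma ind_some {V : Type*} (W : Set V) (v : V) [Decidable (v ∈ W)] :
    ind W (some v) = if v ∈ W then 1 else 0 := by
  unfold ind
  congr 1
  simp

variable {V L : Type*} (Γ : LinkLattice V L)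

/-- The coefficient of `ε_l` in `C_W`. -/
def coeff (W : Set V) (l : L) : ℤ := ind W (Γ.src l) - ind W (Γ.tgt l)

lemma finsum_elec_single (P : L → Prop) [DecidablePred P] (k : L →₀ ℤ) :
    opSum (fun l : {l : L // P l} => elec l.1) (Finsupp.single k 1) =
      Finsupp.single k (∑ l ∈ k.support, (k l : ℂ) * (if P l then 1 else 0)) := by
  rw [opSum_single]
  simp only [elec_single]
  rw [← Finsupp.singleAddHom_apply, map_sum]
  refine (finsum_set_coe_eq_finsum_mem (s := {l | P l})
    (f := fun l => Finsupp.single k (k l : ℂ))).trans ?_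
  rw [finsum_mem_def, finsum_eq_sum_of_support_subset (s := k.support)]
  · refine Finset.sum_congr rfl fun l _ => ?_
    by_cases h : P l <;> simp [h, Set.indicator]
  · intro l hl
    rw [Finset.mem_coe, Finsupp.mem_support_iff]
    intro h0
    simp [h0] at hl

lemma gauss_single (v : V) (k : L →₀ ℤ) : Γ.gauss v (Finsupp.single k 1) =
    Finsupp.single k (∑ l ∈ k.support, (k l : ℂ) * (Γ.coeff {v} l : ℂ)) := by
  classical
  rw [gauss, LinearMap.sub_apply, finsum_elec_single, finsum_elec_single, ← Finsupp.single_sub,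
    ← Finset.sum_sub_distrib]
  congr 1
  refine Finset.sum_congr rfl fun l _ => ?_
  rw [← mul_sub, coeff, ind, ind]
  congr 1
  push_cast
  congr <;> simp

lemma isDiag_gauss (v : V) : IsDiag (Γ.gauss v) fun l => Γ.coeff {v} l := by
  intro k
  rw [gauss_single]
  simp

lemma ind_singleton_support_finite (o : Option V) :
    (Function.support fun v => ind {v} o).Finite := by
  classical
  cases o with
  | none => simp
  | some w =>
    refine (Set.finite_singleton w).subset fun v hv => ?_
    by_contra h
    simp [ind_some, Ne.symm h] at hv

lemma finsum_ind_singleton (W : Set V) (o : Option V) : ∑ᶠ v : W, ind {v.1} o = ind W o := by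
  classical
  cases o with
  | none => simp
  | some w =>
    refine (finsum_set_coe_eq_finsum_mem (s := W) (f := fun v => ind {v} (some w))).trans ?_
    rw [finsum_mem_def, finsum_eq_single _ w]
    · simp [Set.indicator, ind_some]
    · intro v hv
      simp [Set.indicator, ind_some, hv.symm]

lemma coeff_singleton_support_finite (l : L) :
    (Function.support fun v => Γ.coeff {v} l).Finite :=
  ((ind_singleton_support_finite (Γ.src l)).union
    (ind_singleton_support_finite (Γ.tgt l))).subset (Function.support_sub _ _)

lemma finsum_coeff_singleton (W : Set V) (l : L) :
    ∑ᶠ v : W, Γ.coeff {v.1} l = Γ.coeff W l := by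
  rw [coeff, ← finsum_ind_singleton W, ← finsum_ind_singleton W]
  exact finsum_sub_distrib
    ((ind_singleton_support_finite (Γ.src l)).preimage Subtype.val_injective.injOn)
    ((ind_singleton_support_finite (Γ.tgt l)).preimage Subtype.val_injective.injOn)

/-- A flux state excites finitely many links and each link has at most two ends, so only finitely
many vertices contribute and the two sums may be exchanged. -/
lemma isDiag_gaussSum (W : Set V) : IsDiag (Γ.gaussSum W) fun l => Γ.coeff W l := by
  intro k
  rw [gaussSum, opSum_single]
  simp only [gauss_single]
  have hfin : ∀ l, (Function.support fun v : W => (k l : ℂ) * (Γ.coeff {v.1} l : ℂ)).Finite := by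
    intro l
    refine ((Γ.coeff_singleton_support_finite l).preimage
      (Subtype.val_injective (p := (· ∈ W))).injOn).subset fun v hv h0 => hv ?_
    simp only [h0, Int.cast_zero, mul_zero]
  have hfin' : (Function.support fun v : W =>
      ∑ l ∈ k.support, (k l : ℂ) * (Γ.coeff {v.1} l : ℂ)).Finite :=
    (k.support.finite_toSet.biUnion fun l _ => hfin l).subset fun v hv => by
      obtain ⟨l, hl, h⟩ := Finset.exists_ne_zero_of_sum_ne_zero hv
      exact Set.mem_biUnion hl h
  refine (AddMonoidHom.map_finsum (Finsupp.singleAddHom k) hfin').symm.trans ?_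
  rw [Finsupp.singleAddHom_apply, finsum_sum_comm _ _ fun l _ => hfin l]
  congr 1
  refine Finset.sum_congr rfl fun l _ => ?_
  rw [← mul_finsum, ← finsum_coeff_singleton]
  congr 1
  have := AddMonoidHom.map_finsum (Int.castAddHom ℂ) (f := fun v : W => Γ.coeff {v.1} l)
    ((Γ.coeff_singleton_support_finite l).preimage Subtype.val_injective.injOn)
  simpa using this.symm

/-- If the constraints sum to zero, then no link has exactly one end. -/
lemma isSome_src_eq_isSome_tgt (hΓ : Γ.gaussSum Set.univ = 0) (l : L) :
    (Γ.src l).isSome = (Γ.tgt l).isSome := by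
  classical
  -- On one unit of flux at `l`, the total constraint has the eigenvalue (1 if the source exists)
  -- minus (1 if the target exists).
  have h := Γ.isDiag_gaussSum Set.univ (Finsupp.single l 1)
  rw [hΓ, LinearMap.zero_apply, eq_comm, Finsupp.single_eq_zero,
    Finsupp.support_single _ one_ne_zero, Finset.sum_singleton, Finsupp.single_eq_same] at h
  have h' : Γ.coeff Set.univ l = 0 := by
    simpa using h
  rw [coeff] at h'
  cases hs : Γ.src l <;> cases ht : Γ.tgt l <;> simp_all [ind_some]

/-! ### Gauge transformations as angle shifts -/

/-- The angle by which `Γ.gauge` shifts the link `l`. -/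
def linkAngle {M : Type*} [AddCommGroup M] (μ : V → M) (l : L) : M :=
  (Γ.tgt l).elim 0 μ - (Γ.src l).elim 0 μ

lemma gauge_eq_shift (lam : V → ℝ) : Γ.gauge lam = shift (Γ.linkAngle (ang lam)) := by
  rw [gauge, tensorX]
  congr 1
  funext l
  rw [ang, linkAngle, AddCircle.coe_sub]
  cases Γ.tgt l <;> cases Γ.src l <;> rfl

lemma finsum_ind_singleton_zsmul {M : Type*} [AddCommGroup M] (μ : V → M) (o : Option V) :
    ∑ᶠ v, ind {v} o • μ v = o.elim 0 μ := by
  classical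
  cases o with
  | none => simp
  | some w =>
    rw [finsum_eq_single _ w]
    · simp [ind_some]
    · intro v hv
      simp [ind_some, hv.symm]

lemma finsum_coeff_singleton_zsmul {M : Type*} [AddCommGroup M] (μ : V → M) (l : L) :
    ∑ᶠ v, Γ.coeff {v} l • μ v = -Γ.linkAngle μ l := by
  simp only [coeff, sub_smul]
  rw [finsum_sub_distrib, finsum_ind_singleton_zsmul, finsum_ind_singleton_zsmul, linkAngle,
    neg_sub]
  · exact (ind_singleton_support_finite (Γ.src l)).subset
      (Function.support_smul_subset_left (fun v => ind {v} (Γ.src l)) μ)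
  · exact (ind_singleton_support_finite (Γ.tgt l)).subset
      (Function.support_smul_subset_left (fun v => ind {v} (Γ.tgt l)) μ)

/-- The coefficients are integers, so the total angle is well defined in terms of the `lam j` modulo
`2π`. -/
lemma isExpProd_shift_coeff [Countable L] {ι : Type*} (W : ι → Set V) (lam : ι → ℝ)
    (hW : ∀ l, {j | Γ.coeff (W j) l ≠ 0}.Finite) {A : ι → Module.End ℂ (FluxVec L)}
    (hA : ∀ j, IsDiag (A j) fun l => Γ.coeff (W j) l) :
    IsExpProd (fun j => (lam j : ℂ) • A j)
      (shift fun l => -∑ᶠ j, Γ.coeff (W j) l • ang lam j) := by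
  have h := isExpProd_shift (fun j => (hA j).smul (lam j)) fun l =>
    (hW l).subset fun j hj h0 => hj (by simp [h0])
  convert h using 5 with l
  funext j
  change Γ.coeff (W j) l • ((lam j : ℝ) : U1) = _
  rw [← AddCircle.coe_zsmul, zsmul_eq_mul, mul_comm (lam j)]

lemma isExpProd_gauge [Countable L] (lam : V → ℝ) :
    IsExpProd (fun v => (lam v : ℂ) • Γ.gauss v) (Γ.gauge lam) := by
  rw [gauge_eq_shift]
  have h := Γ.isExpProd_shift_coeff (fun v => {v}) lam Γ.coeff_singleton_support_finite
    Γ.isDiag_gauss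
  simpa only [finsum_coeff_singleton_zsmul, neg_neg] using h

lemma coeff_restrict (R : Set L) (W : Set V) (l : R) : (Γ.restrict R).coeff W l = Γ.coeff W l :=
  rfl

/-! ### Fundamental cuts of a spanning tree -/

/-- The vertices which are connected to the target of `e` by the links in `T` other than `e`. -/
def cut (T : Set L) (e : L) : Set V :=
  {v | ∃ w, Γ.tgt e = some w ∧ (Γ.linkGraph (T \ {e})).Reachable w v}

variable {Γ} {T : Set L}

lemma linkGraph_adj_of_link {R : Set L} {l : L} (hl : l ∈ R) {v w : V} (hvw : v ≠ w)
    (hs : Γ.src l = some v) (ht : Γ.tgt l = some w) : (Γ.linkGraph R).Adj v w :=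
  ⟨hvw, Or.inl ⟨l, hl, hs, ht⟩⟩

/-- The graph forgets which link produced an edge; `simple` guarantees that no parallel or reversed
link keeps the edge of `e` alive once `e` is deleted. -/
lemma IsSpanningTree.linkGraph_diff_le (hT : Γ.IsSpanningTree T) {e : L} (he : e ∈ T) {v w : V}
    (hs : Γ.src e = some v) (ht : Γ.tgt e = some w) :
    Γ.linkGraph (T \ {e}) ≤ Γ.linkGraph T \ SimpleGraph.fromEdgeSet {s(v, w)} := by
  intro x y hxy
  obtain ⟨hne, h⟩ := hxy
  have key : ∀ l ∈ T \ {e}, ∀ {x y}, Γ.src l = some x → Γ.tgt l = some y → s(x, y) ≠ s(v, w) := by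
    intro l hl x y hx hy hxy
    refine hl.2 (hT.simple l hl.1 e he ?_)
    rw [Sym2.eq_iff] at hxy
    rcases hxy with ⟨rfl, rfl⟩ | ⟨rfl, rfl⟩
    · exact Or.inl ⟨hx.trans hs.symm, hy.trans ht.symm⟩
    · exact Or.inr ⟨hx.trans ht.symm, hy.trans hs.symm⟩
  rw [SimpleGraph.sdiff_adj, SimpleGraph.fromEdgeSet_adj, Set.mem_singleton_iff]
  rcases h with ⟨l, hl, hx, hy⟩ | ⟨l, hl, hx, hy⟩
  · exact ⟨⟨hne, Or.inl ⟨l, hl.1, hx, hy⟩⟩, fun h => key l hl hx hy h.1⟩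
  · exact ⟨⟨hne, Or.inr ⟨l, hl.1, hx, hy⟩⟩, fun h => key l hl hx hy (Sym2.eq_swap.trans h.1)⟩

/-- Every edge of an acyclic graph is a bridge, so deleting `e` disconnects its ends. -/
lemma IsSpanningTree.src_notMem_cut (hT : Γ.IsSpanningTree T) {e : L} (he : e ∈ T) {v : V}
    (hs : Γ.src e = some v) : v ∉ Γ.cut T e := by
  obtain ⟨v', w, hvw, hs', ht⟩ := hT.ends e he
  obtain rfl : v = v' := Option.some_injective _ (hs.symm.trans hs')
  rintro ⟨w', hw', hr⟩
  obtain rfl : w = w' := Option.some_injective _ (ht.symm.trans hw')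
  have hadj := linkGraph_adj_of_link he hvw hs ht
  have hb := SimpleGraph.isAcyclic_iff_forall_adj_isBridge.mp hT.tree.isAcyclic hadj
  rw [SimpleGraph.isBridge_iff] at hb
  exact hb ((hr.mono (hT.linkGraph_diff_le he hs ht)).symm)

lemma tgt_mem_cut {e : L} {w : V} (ht : Γ.tgt e = some w) : w ∈ Γ.cut T e := ⟨w, ht, .rfl⟩

lemma mem_cut_iff_of_adj {e : L} {v w : V} (h : (Γ.linkGraph (T \ {e})).Adj v w) :
    v ∈ Γ.cut T e ↔ w ∈ Γ.cut T e :=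
  ⟨fun ⟨x, hx, hr⟩ => ⟨x, hx, hr.trans h.reachable⟩,
    fun ⟨x, hx, hr⟩ => ⟨x, hx, hr.trans h.symm.reachable⟩⟩

/-- The only link of the tree which crosses the cut of `e` is `e`. -/
lemma IsSpanningTree.coeff_cut [DecidableEq L] (hT : Γ.IsSpanningTree T) {e l : L} (he : e ∈ T)
    (hl : l ∈ T) : Γ.coeff (Γ.cut T e) l = if l = e then -1 else 0 := by
  classical
  obtain ⟨v, w, hvw, hs, ht⟩ := hT.ends l hl
  rw [coeff, hs, ht, ind_some, ind_some]
  by_cases hle : l = e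
  · subst hle
    rw [if_neg (hT.src_notMem_cut hl hs), if_pos (tgt_mem_cut ht), if_pos rfl, zero_sub]
  · rw [if_neg hle, sub_eq_zero]
    -- A tree link other than `e` survives the deletion, so both its ends lie on the same side.
    exact if_congr (mem_cut_iff_of_adj
      (linkGraph_adj_of_link (R := T \ {e}) ⟨hl, hle⟩ hvw hs ht)) rfl rfl

/-- Reduces an assertion about pairs of vertices to the two ends of a single tree link, by following
a tree path. -/
lemma IsSpanningTree.induction (hT : Γ.IsSpanningTree T) {P : V → V → Prop}
    (refl : ∀ v, P v v) (symm : ∀ {v w}, P v w → P w v) (trans : ∀ {u v w}, P u v → P v w → P u w)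
    (link : ∀ l ∈ T, ∀ {v w}, Γ.src l = some v → Γ.tgt l = some w → P v w) (v w : V) : P v w := by
  have h := (SimpleGraph.reachable_iff_reflTransGen v w).mp (hT.tree.preconnected v w)
  induction h with
  | refl => exact refl v
  | tail _ hadj ih =>
    refine trans ih ?_
    obtain ⟨-, ⟨l, hl, hs, ht⟩ | ⟨l, hl, hs, ht⟩⟩ := hadj
    · exact link l hl hs ht
    · exact symm (link l hl hs ht)

/-- Only finitely many fundamental cuts separate two given vertices. -/
lemma IsSpanningTree.finite_cut (hT : Γ.IsSpanningTree T) (v w : V) :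
    (Function.support fun e : T =>
      ind (Γ.cut T e) (some v) - ind (Γ.cut T e) (some w)).Finite := by
  classical
  refine hT.induction (P := fun v w => (Function.support fun e : T =>
      ind (Γ.cut T e) (some v) - ind (Γ.cut T e) (some w)).Finite) (fun v => by simp) ?_ ?_ ?_ v w
  · intro v w h
    refine h.subset fun e he h0 => he ?_
    simp only at h0 ⊢
    omega
  · intro u v w h h'
    refine (h.union h').subset fun e he => ?_
    by_contra h0
    simp only [Set.mem_union, Function.mem_support, ne_eq, not_or, not_not] at h0 he
    omega
  -- The ends of `l` are separated by its own cut only.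
  · intro l hl v w hs ht
    refine (Set.finite_singleton (⟨l, hl⟩ : T)).subset fun e he => ?_
    have h := hT.coeff_cut e.2 hl
    rw [coeff, hs, ht] at h
    by_contra hne
    refine he (h.trans (if_neg fun h => hne (Subtype.ext h.symm)))

/-- The potential difference between two vertices, from the differences along the tree. -/
lemma IsSpanningTree.finsum_cut (hT : Γ.IsSpanningTree T) {M : Type*} [AddCommGroup M] (μ : V → M)
    (v w : V) :
    ∑ᶠ e : T, (ind (Γ.cut T e) (some v) - ind (Γ.cut T e) (some w)) • Γ.linkAngle μ e =
      μ v - μ w := by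
  classical
  refine hT.induction (P := fun v w =>
    ∑ᶠ e : T, (ind (Γ.cut T e) (some v) - ind (Γ.cut T e) (some w)) • Γ.linkAngle μ e =
      μ v - μ w) (fun v => by simp) ?_ ?_ ?_ v w
  · intro v w h
    rw [← neg_sub, ← h, ← finsum_neg_distrib]
    exact finsum_congr fun e => by rw [← neg_smul, neg_sub]
  · intro u v w h h'
    -- Differences telescope along the path. Finite supports are required here because `finsum` is
    -- zero on infinite ones and so is not additive in general.
    rw [← sub_add_sub_cancel (μ u) (μ v), ← h, ← h', ← finsum_add_distrib]
    · exact finsum_congr fun e => by rw [← add_smul, sub_add_sub_cancel]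
    · exact (hT.finite_cut u v).subset (Function.support_smul_subset_left
        (fun e : T => ind (Γ.cut T e) (some u) - ind (Γ.cut T e) (some v)) _)
    · exact (hT.finite_cut v w).subset (Function.support_smul_subset_left
        (fun e : T => ind (Γ.cut T e) (some v) - ind (Γ.cut T e) (some w)) _)
  · intro l hl v w hs ht
    have h : ∀ e : T, ind (Γ.cut T e) (some v) - ind (Γ.cut T e) (some w) =
        if l = e then -1 else 0 := by
      intro e
      rw [← hT.coeff_cut e.2 hl, coeff, hs, ht]
    simp only [h]
    rw [finsum_eq_single _ (⟨l, hl⟩ : T)]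
    · simp [linkAngle, hs, ht]
    · intro e he
      rw [if_neg fun h => he (Subtype.ext h.symm), zero_smul]

/-! ### Gauge transformations parametrised by the links of a spanning tree -/

/-- For a two-ended link this is `finite_cut`, and a link without ends crosses no cut. A one-ended
link could meet infinitely many cuts; `hΓ` rules it out. -/
lemma IsSpanningTree.finite_coeff_cut (hT : Γ.IsSpanningTree T) (hΓ : Γ.gaussSum Set.univ = 0)
    (l : L) : (Function.support fun e : T => Γ.coeff (Γ.cut T e) l).Finite := by
  have h := Γ.isSome_src_eq_isSome_tgt hΓ l
  cases hs : Γ.src l <;> cases ht : Γ.tgt l <;> simp only [hs, ht] at h <;> try cases h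
  · simp [coeff, hs, ht]
  · simpa only [coeff, hs, ht] using hT.finite_cut _ _

variable (Γ T) in
/-- The angle by which the gauge transformation with angles `a` on the tree shifts a link. -/
def treeAngle {M : Type*} [AddCommGroup M] (a : T → M) (l : L) : M :=
  -∑ᶠ e : T, Γ.coeff (Γ.cut T e) l • a e

lemma IsSpanningTree.treeAngle_add (hT : Γ.IsSpanningTree T) (hΓ : Γ.gaussSum Set.univ = 0)
    {M : Type*} [AddCommGroup M] (a b : T → M) :
    Γ.treeAngle T (a + b) = Γ.treeAngle T a + Γ.treeAngle T b := by
  funext l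
  rw [Pi.add_apply, treeAngle, treeAngle, treeAngle, ← neg_add, ← finsum_add_distrib]
  · simp
  · exact (hT.finite_coeff_cut hΓ l).subset
      (Function.support_smul_subset_left (fun e : T => Γ.coeff (Γ.cut T e) l) a)
  · exact (hT.finite_coeff_cut hΓ l).subset
      (Function.support_smul_subset_left (fun e : T => Γ.coeff (Γ.cut T e) l) b)

/-- Each component is a sum over a finite set of tree links that does not depend on the angles. -/
lemma IsSpanningTree.continuous_treeAngle (hT : Γ.IsSpanningTree T)
    (hΓ : Γ.gaussSum Set.univ = 0) : Continuous (Γ.treeAngle T : (T → U1) → L → U1) := by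
  refine continuous_pi fun l => ?_
  have h : (fun a : T → U1 => Γ.treeAngle T a l) =
      fun a => -∑ e ∈ (hT.finite_coeff_cut hΓ l).toFinset, Γ.coeff (Γ.cut T e) l • a e := by
    funext a
    rw [treeAngle, finsum_eq_sum_of_support_subset]
    rw [Set.Finite.coe_toFinset]
    exact Function.support_smul_subset_left (fun e : T => Γ.coeff (Γ.cut T e) l) a
  rw [h]
  fun_prop

lemma IsSpanningTree.treeAngle_coe (hT : Γ.IsSpanningTree T) {M : Type*} [AddCommGroup M]
    (a : T → M) (l : T) : Γ.treeAngle T a l = a l := by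
  classical
  rw [treeAngle, finsum_eq_single _ l]
  · rw [hT.coeff_cut l.2 l.2, if_pos rfl, neg_one_smul, neg_neg]
  · intro e he
    rw [hT.coeff_cut e.2 l.2, if_neg fun h => he (Subtype.ext h.symm), zero_smul]

lemma IsSpanningTree.treeAngle_linkAngle (hT : Γ.IsSpanningTree T)
    (hΓ : Γ.gaussSum Set.univ = 0) {M : Type*} [AddCommGroup M] (μ : V → M) :
    (Γ.treeAngle T fun e => Γ.linkAngle μ e) = Γ.linkAngle μ := by
  funext l
  have h := Γ.isSome_src_eq_isSome_tgt hΓ l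
  cases hs : Γ.src l <;> cases ht : Γ.tgt l <;> simp only [hs, ht] at h <;> try cases h
  · simp [treeAngle, coeff, linkAngle, hs, ht]
  · simp only [treeAngle, coeff, hs, ht, hT.finsum_cut μ]
    simp [linkAngle, hs, ht]

lemma IsSpanningTree.exists_linkAngle_eq_treeAngle (hT : Γ.IsSpanningTree T)
    (hΓ : Γ.gaussSum Set.univ = 0) {M : Type*} [AddCommGroup M] (a : T → M) :
    ∃ μ : V → M, Γ.linkAngle μ = Γ.treeAngle T a := by
  obtain ⟨v₀⟩ := hT.tree.nonempty
  -- The potential adds up `a` along the tree path from `v₀` to `v`, with signs. Subtracting the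
  -- indicator at `v₀` leaves only the cuts separating `v` from `v₀`, so the sum is finite even for
  -- an infinite tree.
  refine ⟨fun v => ∑ᶠ e : T, (ind (Γ.cut T e) (some v) - ind (Γ.cut T e) (some v₀)) • a e, ?_⟩
  funext l
  have h := Γ.isSome_src_eq_isSome_tgt hΓ l
  cases hs : Γ.src l <;> cases ht : Γ.tgt l <;> simp only [hs, ht] at h <;> try cases h
  · simp [treeAngle, coeff, linkAngle, hs, ht]
  · rename_i v w
    simp only [linkAngle, treeAngle, coeff, hs, ht, Option.elim_some]
    rw [← finsum_sub_distrib, ← finsum_neg_distrib]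
    · refine finsum_congr fun e => ?_
      rw [← sub_smul, ← neg_smul]
      congr 1
      ring
    · exact (hT.finite_cut w v₀).subset (Function.support_smul_subset_left
        (fun e : T => ind (Γ.cut T e) (some w) - ind (Γ.cut T e) (some v₀)) _)
    · exact (hT.finite_cut v v₀).subset (Function.support_smul_subset_left
        (fun e : T => ind (Γ.cut T e) (some v) - ind (Γ.cut T e) (some v₀)) _)

end LinkLattice

/-- Representatives in `[0, 2π)` of a family of angles. -/
def angRep {I : Type*} (a : I → U1) (i : I) : ℝ := (AddCircle.equivIco (2 * Real.pi) 0 (a i)).1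

lemma angRep_mem {I : Type*} (a : I → U1) (i : I) : angRep a i ∈ Set.Ico 0 (2 * Real.pi) := by
  simpa [angRep] using (AddCircle.equivIco (2 * Real.pi) 0 (a i)).2

@[simp] lemma ang_angRep {I : Type*} (a : I → U1) : ang (angRep a) = a :=
  funext fun i => (AddCircle.equivIco (2 * Real.pi) 0).symm_apply_apply (a i)

lemma angRep_ang {I : Type*} {lam : I → ℝ} (h : ∀ i, lam i ∈ Set.Ico 0 (2 * Real.pi)) :
    angRep (ang lam) = lam :=
  funext fun i => congrArg Subtype.val
    ((AddCircle.equivIco (2 * Real.pi) 0).apply_symm_apply ⟨lam i, by simpa using h i⟩)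

lemma LinkLattice.IsSpanningTree.bijOn_gaugeGroup {V L : Type*} {Γ : LinkLattice V L} {T : Set L}
    (hT : Γ.IsSpanningTree T) (hΓ : Γ.gaussSum Set.univ = 0) :
    Set.BijOn (fun lam : T → ℝ => shift (Γ.treeAngle T (ang lam)))
      {lam | ∀ l, lam l ∈ Set.Ico 0 (2 * Real.pi)} Γ.gaugeGroup := by
  refine ⟨fun lam _ => ?_, fun lam h lam' h' heq => ?_, ?_⟩
  · obtain ⟨μ, hμ⟩ := hT.exists_linkAngle_eq_treeAngle hΓ (ang lam)
    exact ⟨angRep μ, angRep_mem μ, by simp only [Γ.gauge_eq_shift, ang_angRep, hμ]⟩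
  -- Restricted to the tree links, the translation angles are the parameters themselves.
  · have h1 : ang lam = ang lam' := funext fun l => by
      rw [← hT.treeAngle_coe (ang lam), shift_injective L heq, hT.treeAngle_coe]
    rw [← angRep_ang h, h1, angRep_ang h']
  · rintro _ ⟨μ, -, rfl⟩
    refine ⟨angRep fun e : T => Γ.linkAngle (ang μ) e, angRep_mem _, ?_⟩
    simp only [ang_angRep, Γ.gauge_eq_shift, hT.treeAngle_linkAngle hΓ]

/-! ### `RotorSpace` as a tensor product of rotors -/

lemma measurePreserving_eval_rotor {I : Type*} (i : I) :
    MeasurePreserving (fun x : I → U1 => x i) (rotorMeasure I)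
      (AddCircle.haarAddCircle : Measure U1) :=
  measurePreserving_eval_infinitePi _ i

lemma measurePreserving_finsetRestrict {I : Type*} (s : Finset I) :
    MeasurePreserving (s.restrict : (I → U1) → (s → U1)) (rotorMeasure I)
      (Measure.pi fun _ : s => (AddCircle.haarAddCircle : Measure U1)) :=
  ⟨s.measurable_restrict, Measure.infinitePi_map_restrict _⟩

lemma integrable_prod_rotor {I 𝕜 : Type*} [RCLike 𝕜] {s : Finset I} {f : I → U1 → 𝕜}
    (hf : ∀ i, Integrable (f i) AddCircle.haarAddCircle) :
    Integrable (fun x : I → U1 => ∏ i ∈ s, f i (x i)) (rotorMeasure I) := by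
  have h := (measurePreserving_finsetRestrict s).integrable_comp_of_integrable
    (Integrable.fintype_prod_dep (f := fun i : s => f i) fun i => hf i)
  refine h.congr (ae_of_all _ fun x => ?_)
  exact Finset.prod_coe_sort s fun i => f i (x i)

lemma integral_prod_rotor {I 𝕜 : Type*} [RCLike 𝕜] {s : Finset I} {f : I → U1 → 𝕜}
    (hf : ∀ i, Integrable (f i) AddCircle.haarAddCircle) :
    ∫ x, ∏ i ∈ s, f i (x i) ∂rotorMeasure I =
      ∏ i ∈ s, ∫ x, f i x ∂(AddCircle.haarAddCircle : Measure U1) := by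
  have h := integral_fintype_prod_eq_prod (fun i : s => f i)
    (μ := fun _ => (AddCircle.haarAddCircle : Measure U1))
  have h2 := integral_restrict_infinitePi (s := s)
    (μ := fun _ : I => (AddCircle.haarAddCircle : Measure U1))
    (Integrable.fintype_prod_dep (f := fun i : s => f i) fun i => hf i).aestronglyMeasurable
  rw [h, Finset.prod_coe_sort s fun i => ∫ x, f i x ∂(AddCircle.haarAddCircle : Measure U1)] at h2
  rw [← h2]
  exact integral_congr_ae (ae_of_all _ fun x => (Finset.prod_coe_sort s fun i => f i (x i)).symm)

lemma memLp_prod_rotor {I : Type*} (s : Finset I) (ψ : I → Rotor) :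
    MemLp (fun x : I → U1 => ∏ i ∈ s, ψ i (x i)) 2 (rotorMeasure I) := by
  rw [memLp_two_iff_integrable_sq_norm]
  · simp only [norm_prod, ← Finset.prod_pow]
    exact integrable_prod_rotor (f := fun i x => ‖ψ i x‖ ^ 2) fun i =>
      (memLp_two_iff_integrable_sq_norm (Lp.aestronglyMeasurable _)).mp (Lp.memLp (ψ i))
  · exact Finset.aestronglyMeasurable_fun_prod s fun i _ =>
      (Lp.aestronglyMeasurable (ψ i)).comp_measurePreserving (measurePreserving_eval_rotor i)

/-- Inner products factorise by Fubini's theorem, and the flux states, whose span is dense, are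
themselves product vectors. -/
lemma isRotorTensorProduct (I : Type*) [Countable I] : IsRotorTensorProduct I := by
  refine ⟨fun s ψ => (memLp_prod_rotor s ψ).toLp _, fun s ψ => MemLp.coeFn_toLp _,
    fun s ψ ψ' => ?_, ?_⟩
  · simp only [L2.inner_def]
    rw [← integral_prod_rotor fun i => L2.integrable_inner (𝕜 := ℂ) (ψ i) (ψ' i)]
    refine integral_congr_ae ?_
    filter_upwards [MemLp.coeFn_toLp (memLp_prod_rotor s ψ),
      MemLp.coeFn_toLp (memLp_prod_rotor s ψ')] with x h h'
    rw [h, h']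
    simp only [RCLike.inner_apply, map_prod, Finset.prod_mul_distrib]
  · refine (dense_span_fluxKet I).mono (Submodule.span_mono ?_)
    rintro _ ⟨k, rfl⟩
    refine ⟨k.support, fun i => fourierLp 2 (k i), Lp.ext ?_⟩
    -- Each factor equals its character off a null set of `U(1)`, which evaluation at `i` pulls back
    -- to a null set; finitely many such sets are discarded.
    have h : ∀ᵐ x ∂rotorMeasure I, ∀ i ∈ k.support,
        (fourierLp 2 (k i) : Rotor) (x i) = fourier (k i) (x i) := by
      refine (Finset.eventually_all _).mpr fun i _ => ?_
      exact (measurePreserving_eval_rotor i).quasiMeasurePreserving.ae (coeFn_fourierLp 2 (k i))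
    filter_upwards [MemLp.coeFn_toLp (memLp_prod_rotor k.support fun i => fourierLp 2 (k i)),
      MemLp.coeFn_toLp (memLp_fluxFun k), h] with x h1 h2 h3
    exact h1.trans ((Finset.prod_congr rfl h3).trans h2.symm)

/-! ### Splitting the links into two sets -/

/-- The inverse gluing map `m` pushes the product measure forward to a measure with the right values
on finite boxes, which determine `rotorMeasure L`. -/
lemma measurePreserving_split {L : Type*} (T : Set L) :
    MeasurePreserving (fun x : L → U1 => ((fun l : T => x l), (fun l : (Tᶜ : Set L) => x l)))
      (rotorMeasure L) ((rotorMeasure T).prod (rotorMeasure (Tᶜ : Set L))) := by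
  classical
  let m : (T → U1) × ((Tᶜ : Set L) → U1) → L → U1 := fun p l =>
    if h : l ∈ T then p.1 ⟨l, h⟩ else p.2 ⟨l, h⟩
  have hm : Measurable m := by
    refine measurable_pi_lambda _ fun l => ?_
    by_cases h : l ∈ T <;> simp only [m, h, dite_true, dite_false] <;> fun_prop
  have hmap : ((rotorMeasure T).prod (rotorMeasure (Tᶜ : Set L))).map m = rotorMeasure L := by
    refine Measure.eq_infinitePi _ fun s t ht => ?_
    have hpre : m ⁻¹' (Set.pi s t) =
        (Set.pi (s.subtype (· ∈ T)) fun l : T => t l) ×ˢ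
          (Set.pi (s.subtype (· ∈ Tᶜ)) fun l : (Tᶜ : Set L) => t l) := by
      ext p
      simp only [Set.mem_preimage, Set.mem_pi, Set.mem_prod, Finset.mem_coe, Finset.mem_subtype, m]
      constructor
      · intro h
        refine ⟨fun l hl => ?_, fun l hl => ?_⟩
        · simpa using h l hl
        · have hl' : l.1 ∉ T := l.2
          simpa [hl'] using h l hl
      · rintro ⟨h1, h2⟩ l hl
        by_cases h : l ∈ T
        · simpa [h] using h1 ⟨l, h⟩ hl
        · simpa [h] using h2 ⟨l, h⟩ hl
    rw [Measure.map_apply hm (MeasurableSet.pi s.countable_toSet fun i _ => ht i), hpre,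
      Measure.prod_prod, rotorMeasure, rotorMeasure, Measure.infinitePi_pi _ (t := fun l : T => t l) fun i _ => ht i,
      Measure.infinitePi_pi _ (t := fun l : (Tᶜ : Set L) => t l) fun i _ => ht i,
      ← Finset.prod_filter_mul_prod_filter_not s (· ∈ T)]
    congr 1
    · rw [← Finset.subtype_map, Finset.prod_map]; rfl
    · rw [← Finset.subtype_map, Finset.prod_map]; rfl
  refine ⟨by fun_prop, ?_⟩
  rw [← hmap, Measure.map_map (by fun_prop) hm]
  convert Measure.map_id using 2
  funext p
  refine Prod.ext (funext fun l => ?_) (funext fun l => ?_)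
  · simp [m]
  · have hl : l.1 ∉ T := l.2
    simp [m, hl]

lemma measurePreserving_restrict {L : Type*} (R : Set L) :
    MeasurePreserving (fun (x : L → U1) (l : R) => x l) (rotorMeasure L) (rotorMeasure R) :=
  measurePreserving_fst.comp (measurePreserving_split R)

/-! ### The Hilbert space factorisation induced by the splitting -/

section
variable {L : Type*} (T : Set L)

lemma memLp_splitProd (f : RotorSpace T) (g : RotorSpace (Tᶜ : Set L)) :
    MemLp (fun x : L → U1 => f (fun l => x l) * g (fun l => x l)) 2 (rotorMeasure L) := by
  rw [memLp_two_iff_integrable_sq_norm]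
  · simp only [norm_mul, mul_pow]
    exact (measurePreserving_split T).integrable_comp_of_integrable
      (((memLp_two_iff_integrable_sq_norm (Lp.aestronglyMeasurable _)).mp (Lp.memLp f)).mul_prod
        ((memLp_two_iff_integrable_sq_norm (Lp.aestronglyMeasurable _)).mp (Lp.memLp g)))
  · exact ((Lp.aestronglyMeasurable f).comp_measurePreserving (measurePreserving_restrict T)).mul
      ((Lp.aestronglyMeasurable g).comp_measurePreserving (measurePreserving_restrict Tᶜ))

/-- The wave function `f(x|_T) g(x|_{Tᶜ})`. -/
def splitProd (f : RotorSpace T) (g : RotorSpace (Tᶜ : Set L)) : RotorSpace L :=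
  (memLp_splitProd T f g).toLp _

lemma coeFn_splitProd (f : RotorSpace T) (g : RotorSpace (Tᶜ : Set L)) :
    (splitProd T f g : (L → U1) → ℂ) =ᵐ[rotorMeasure L]
      fun x => f (fun l => x l) * g (fun l => x l) :=
  MemLp.coeFn_toLp _

lemma inner_splitProd (f f' : RotorSpace T) (g g' : RotorSpace (Tᶜ : Set L)) :
    inner ℂ (splitProd T f g) (splitProd T f' g') = inner ℂ f f' * inner ℂ g g' := by
  simp only [L2.inner_def]
  rw [← integral_prod_mul, ← (measurePreserving_split T).map_eq, integral_map]
  · refine integral_congr_ae ?_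
    filter_upwards [coeFn_splitProd T f g, coeFn_splitProd T f' g'] with x h h'
    rw [h, h']
    simp only [RCLike.inner_apply, map_mul]
    ring
  · exact (measurePreserving_split T).measurable.aemeasurable
  · rw [(measurePreserving_split T).map_eq]
    exact ((L2.integrable_inner f f').mul_prod (L2.integrable_inner g g')).aestronglyMeasurable

lemma ae_restrict {R : Set L} {p : (R → U1) → Prop} (h : ∀ᵐ x ∂rotorMeasure R, p x) :
    ∀ᵐ x ∂rotorMeasure L, p fun l => x l :=
  (measurePreserving_restrict R).quasiMeasurePreserving.ae h

/-- `splitProd` as a linear map on the algebraic tensor product. -/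
def splitLin : RotorSpace T ⊗[ℂ] RotorSpace (Tᶜ : Set L) →ₗ[ℂ] RotorSpace L :=
  TensorProduct.lift <| LinearMap.mk₂ ℂ (splitProd T)
    (fun f f' g => Lp.ext <| by
      filter_upwards [coeFn_splitProd T (f + f') g, coeFn_splitProd T f g, coeFn_splitProd T f' g,
        Lp.coeFn_add (splitProd T f g) (splitProd T f' g), ae_restrict (Lp.coeFn_add f f')]
        with x h1 h2 h3 h4 h5
      rw [h1, h4, Pi.add_apply, h2, h3, h5, Pi.add_apply, add_mul])
    (fun c f g => Lp.ext <| by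
      filter_upwards [coeFn_splitProd T (c • f) g, coeFn_splitProd T f g,
        Lp.coeFn_smul c (splitProd T f g), ae_restrict (Lp.coeFn_smul c f)] with x h1 h2 h3 h4
      rw [h1, h3, Pi.smul_apply, h2, h4, Pi.smul_apply, smul_mul_assoc])
    (fun f g g' => Lp.ext <| by
      filter_upwards [coeFn_splitProd T f (g + g'), coeFn_splitProd T f g, coeFn_splitProd T f g',
        Lp.coeFn_add (splitProd T f g) (splitProd T f g'), ae_restrict (Lp.coeFn_add g g')]
        with x h1 h2 h3 h4 h5
      rw [h1, h4, Pi.add_apply, h2, h3, h5, Pi.add_apply, mul_add])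
    (fun c f g => Lp.ext <| by
      filter_upwards [coeFn_splitProd T f (c • g), coeFn_splitProd T f g,
        Lp.coeFn_smul c (splitProd T f g), ae_restrict (Lp.coeFn_smul c g)] with x h1 h2 h3 h4
      rw [h1, h3, Pi.smul_apply, h2, h4, Pi.smul_apply, mul_smul_comm])

lemma splitLin_tmul (f : RotorSpace T) (g : RotorSpace (Tᶜ : Set L)) :
    splitLin T (f ⊗ₜ[ℂ] g) = splitProd T f g := by
  simp [splitLin]

lemma inner_splitLin (x y : RotorSpace T ⊗[ℂ] RotorSpace (Tᶜ : Set L)) :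
    inner ℂ (splitLin T x) (splitLin T y) = inner ℂ x y := by
  induction x using TensorProduct.induction_on with
  | zero => simp
  | add x x' hx hx' => rw [map_add, inner_add_left, inner_add_left, hx, hx']
  | tmul f g =>
    induction y using TensorProduct.induction_on with
    | zero => simp
    | add y y' hy hy' => rw [map_add, inner_add_right, inner_add_right, hy, hy']
    | tmul f' g' => rw [splitLin_tmul, splitLin_tmul, inner_splitProd, TensorProduct.inner_tmul]

lemma norm_splitLin (x : RotorSpace T ⊗[ℂ] RotorSpace (Tᶜ : Set L)) : ‖splitLin T x‖ = ‖x‖ :=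
  ((splitLin T).isometryOfInner (inner_splitLin T)).norm_map x

lemma splitProd_fluxKet (k : L →₀ ℤ) : ∃ (p : T →₀ ℤ) (q : (Tᶜ : Set L) →₀ ℤ),
    splitProd T (fluxKet p) (fluxKet q) = fluxKet k := by
  classical
  refine ⟨k.subtypeDomain (· ∈ T), k.subtypeDomain (· ∈ Tᶜ), Lp.ext ?_⟩
  filter_upwards [coeFn_splitProd T (fluxKet (k.subtypeDomain (· ∈ T)))
      (fluxKet (k.subtypeDomain (· ∈ Tᶜ))),
    ae_restrict (MemLp.coeFn_toLp (memLp_fluxFun (k.subtypeDomain (· ∈ T)))),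
    ae_restrict (MemLp.coeFn_toLp (memLp_fluxFun (k.subtypeDomain (· ∈ Tᶜ)))),
    MemLp.coeFn_toLp (memLp_fluxFun k)] with x h1 h2 h3 h4
  refine h1.trans ((congrArg₂ (· * ·) h2 h3).trans (Eq.trans ?_ h4.symm))
  rw [fluxFun, fluxFun, fluxFun, ← Finset.prod_filter_mul_prod_filter_not k.support (· ∈ T)]
  congr 1
  · rw [Finsupp.support_subtypeDomain, ← Finset.subtype_map, Finset.prod_map]; rfl
  · rw [Finsupp.support_subtypeDomain, ← Finset.subtype_map, Finset.prod_map]; rfl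

/-- Every flux state is the product of its restrictions to `T` and to the complement. -/
lemma denseRange_splitLin [Countable L] : DenseRange (splitLin T) := by
  have h : (Submodule.span ℂ (Set.range (fluxKet (I := L))) : Set (RotorSpace L)) ⊆
      LinearMap.range (splitLin T) := by
    refine Submodule.span_le.mpr ?_
    rintro _ ⟨k, rfl⟩
    obtain ⟨p, q, hpq⟩ := splitProd_fluxKet T k
    exact ⟨fluxKet p ⊗ₜ[ℂ] fluxKet q, (splitLin_tmul T _ _).trans hpq⟩
  exact (dense_span_fluxKet L).mono h

/-- The Hilbert space on all links is the tensor product of those on `T` and on the other links. -/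
def splitEquiv [Countable L] : HilbertTensor T (Tᶜ : Set L) ≃ₗᵢ[ℂ] RotorSpace L :=
  (LinearEquiv.refl ℂ (RotorSpace T ⊗[ℂ] RotorSpace (Tᶜ : Set L))).extendOfIsometry
    (UniformSpace.Completion.toComplₗᵢ (𝕜 := ℂ)
      (E := RotorSpace T ⊗[ℂ] RotorSpace (Tᶜ : Set L))).toLinearMap (splitLin T)
    UniformSpace.Completion.denseRange_coe (denseRange_splitLin T)
    fun x => (norm_splitLin T x).trans
      (LinearIsometry.norm_map UniformSpace.Completion.toComplₗᵢ x).symm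

lemma splitEquiv_pureTensor [Countable L] (f : RotorSpace T) (g : RotorSpace (Tᶜ : Set L)) :
    splitEquiv T (pureTensor f g) = splitProd T f g := by
  rw [← splitLin_tmul]
  exact LinearEquiv.extendOfIsometry_eq
    (LinearEquiv.refl ℂ (RotorSpace T ⊗[ℂ] RotorSpace (Tᶜ : Set L)))
    (UniformSpace.Completion.toComplₗᵢ (𝕜 := ℂ)
      (E := RotorSpace T ⊗[ℂ] RotorSpace (Tᶜ : Set L))).toLinearMap (splitLin T)
    UniformSpace.Completion.denseRange_coe (denseRange_splitLin T) _ (f ⊗ₜ[ℂ] g)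

lemma shift_splitProd (a : L → U1) (f : RotorSpace T) (g : RotorSpace (Tᶜ : Set L)) :
    shift a (splitProd T f g) =
      splitProd T (shift (fun l : T => a l) f) (shift (fun l : (Tᶜ : Set L) => a l) g) := by
  refine Lp.ext ?_
  filter_upwards [coeFn_shift a (splitProd T f g),
    (measurePreserving_sub a).quasiMeasurePreserving.ae (coeFn_splitProd T f g),
    coeFn_splitProd T (shift (fun l : T => a l) f) (shift (fun l : (Tᶜ : Set L) => a l) g),
    ae_restrict (coeFn_shift (fun l : T => a l) f),
    ae_restrict (coeFn_shift (fun l : (Tᶜ : Set L) => a l) g)] with x h1 h2 h3 h4 h5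
  rw [h1, h2, h3, h4, h5]
  rfl

lemma shift_splitEquiv_pureTensor [Countable L] (a : L → U1) (f : RotorSpace T)
    (g : RotorSpace (Tᶜ : Set L)) : shift a (splitEquiv T (pureTensor f g)) =
      splitEquiv T (pureTensor (shift (fun l : T => a l) f) (shift (fun l : (Tᶜ : Set L) => a l) g)) := by
  rw [splitEquiv_pureTensor, splitEquiv_pureTensor, shift_splitProd]

end

section
variable {I : Type*} [Countable I]

/-- An invariant probability measure on a compact group is a Haar measure. -/
lemma isAddHaarMeasure_rotorMeasure (I : Type*) [Countable I] :
    (rotorMeasure I).IsAddHaarMeasure := by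
  have : (rotorMeasure I).IsAddLeftInvariant := ⟨fun a => by
    have h := (measurePreserving_sub (-a)).map_eq
    simpa only [sub_neg_eq_add, add_comm _ a] using h⟩
  exact Measure.isAddHaarMeasure_of_isCompact_nonempty_interior _ Set.univ isCompact_univ
    (by simp) (by simp) (by simp)

/-! ### Generalised states -/

@[simp] lemma posKet_apply {X : Type*} [TopologicalSpace X] [CompactSpace X] (x : X)
    (f : C(X, ℂ)) : posKet x f = conj (f x) :=
  rfl

lemma coeFn_testVec (f : C(I → U1, ℂ)) : testVec f =ᵐ[rotorMeasure I] f :=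
  ContinuousMap.coeFn_toLp (p := 2) (𝕜 := ℂ) (rotorMeasure I) f

/-- Haar measure charges nonempty open sets, so continuous functions equal almost everywhere are
equal. -/
lemma testVec_injective : Function.Injective (testVec (I := I)) := by
  have := isAddHaarMeasure_rotorMeasure I
  exact ContinuousMap.toLp_injective (rotorMeasure I)

lemma testVec_comp_add (f : C(I → U1, ℂ)) (a : I → U1) :
    testVec (f.comp ⟨fun x => x + a, by fun_prop⟩) = (shift a).symm (testVec f) := by
  rw [← shift_neg]
  refine Lp.ext ?_
  filter_upwards [coeFn_testVec (f.comp ⟨fun x => x + a, by fun_prop⟩),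
    coeFn_shift (-a) (testVec f),
    (measurePreserving_sub (-a)).quasiMeasurePreserving.ae (coeFn_testVec f)] with x h1 h2 h3
  rw [h1, h2, h3, sub_neg_eq_add]
  rfl

lemma applies_shift_posKet (a b : I → U1) : Applies (shift a) (posKet b) (posKet (a + b)) :=
  fun f => ⟨_, testVec_comp_add f a, by rw [posKet_apply, posKet_apply, add_comm]; rfl⟩

lemma Applies.unique {U : RotorSpace I ≃ₗᵢ[ℂ] RotorSpace I} {Ψ Ψ₁ Ψ₂ : GenState (I → U1)}
    (h₁ : Applies U Ψ Ψ₁) (h₂ : Applies U Ψ Ψ₂) : Ψ₁ = Ψ₂ := by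
  ext f
  obtain ⟨f₁, hf₁, h₁⟩ := h₁ f
  obtain ⟨f₂, hf₂, h₂⟩ := h₂ f
  rw [h₁, h₂, testVec_injective (hf₁.trans hf₂.symm)]

lemma isTensorState_posKet {I : Type*} (x : I → U1) :
    IsTensorState (fun i => posKet (x i)) (posKet x) := by
  intro s f hf
  rw [finprod_eq_prod_of_mulSupport_subset (s := s), posKet_apply, ContinuousMap.prod_apply,
    map_prod]
  · rfl
  · intro i hi
    by_contra h
    exact hi (by simp [hf i h])

/-- The constant test function forces `c = 1`; the characters of single links then read off the
angles. -/
lemma eq_of_posKet_eq_smul {I : Type*} {x y : I → U1} {c : ℂ} (h : posKet x = c • posKet y) : x = y := by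
  have hc : (1 : ℂ) = c := by simpa using congrArg (fun Ψ : GenState (I → U1) => Ψ 1) h
  funext i
  have h2 : fluxFun (Finsupp.single i 1) x = fluxFun (Finsupp.single i 1) y := by
    have := congrArg (fun Ψ : GenState (I → U1) => Ψ (fluxMap (Finsupp.single i 1))) h
    rw [← hc, one_smul] at this
    exact (starRingEnd ℂ).injective this
  rw [fluxFun_single_one, fluxFun_single_one, Circle.coe_inj] at h2
  exact AddCircle.injective_toCircle Real.two_pi_pos.ne' h2

/-! ### Position states as a complete ideal frame -/

lemma isCompleteFrame_shift :
    IsCompleteFrame (shift (I := I)) fun a : I → U1 => posKet a := by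
  intro g' g
  constructor
  · rintro ⟨θ, h⟩
    have := eq_of_posKet_eq_smul ((applies_shift_posKet g' g).unique h)
    simpa using this
  · rintro rfl
    refine ⟨0, ?_⟩
    simpa using applies_shift_posKet (0 : I → U1) g

/-- Superposing position states with amplitude `a` returns the vector `a`, so the isometry required
in both orthonormality notions is the identity. -/
lemma integrable_and_inner_testVec (a : RotorSpace I) (f : C(I → U1, ℂ)) :
    Integrable (fun g => a g * posKet g f) (rotorMeasure I) ∧
      inner ℂ (testVec f) a = ∫ g, a g * posKet g f ∂rotorMeasure I := by
  have h : (fun g => inner ℂ (testVec f g) (a g)) =ᵐ[rotorMeasure I]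
      fun g => a g * posKet g f := by
    filter_upwards [coeFn_testVec f] with g hg
    rw [hg, RCLike.inner_apply, posKet_apply]
  exact ⟨(L2.integrable_inner (𝕜 := ℂ) (testVec f) a).congr h,
    (L2.inner_def (𝕜 := ℂ) (testVec f) a).trans (integral_congr_ae h)⟩

lemma formalOrthonormalBasis_posKet :
    FormalOrthonormalBasis (rotorMeasure I) fun a : I → U1 => posKet a :=
  ⟨LinearIsometryEquiv.refl ℂ _, integrable_and_inner_testVec⟩

lemma FormalOrthonormalBasis.deltaOrthonormal {Λ : Type*} [MeasurableSpace Λ] {ν : Measure Λ}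
    {φ : Λ → GenState (I → U1)} (h : FormalOrthonormalBasis ν φ) : DeltaOrthonormal ν φ := by
  obtain ⟨W, hW⟩ := h
  exact ⟨W.toLinearIsometry, hW⟩

lemma isIdealQRF_shift :
    IsIdealQRF (rotorMeasure I) (shift (I := I)) fun a : I → U1 => posKet a where
  left :=
    { haar := isAddHaarMeasure_rotorMeasure I
      map_zero := shift_zero
      map_add := shift_add
      strongly_continuous := continuous_shift_apply
      covariant := applies_shift_posKet
      resolution := by
        -- The constant is 1 because position states are normalised with respect to the same Haar
        -- measure.
        refine ⟨1, one_pos, fun f f' => ?_⟩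
        have h : (fun g => testVec f' g * posKet g f) =ᵐ[rotorMeasure I]
            fun g => posKet g f * conj (posKet g f') := by
          filter_upwards [coeFn_testVec f'] with g hg
          rw [hg, posKet_apply, posKet_apply, Complex.conj_conj, mul_comm]
        obtain ⟨h1, h2⟩ := integrable_and_inner_testVec (testVec f') f
        refine ⟨h1.congr h, ?_⟩
        rw [h2, integral_congr_ae h, Complex.ofReal_one, one_mul] }
  right := formalOrthonormalBasis_posKet.deltaOrthonormal

end

/-! ### Angles in `[0, 2π)` -/

section
variable {I : Type*} [Fintype I]

lemma measurable_ang {I : Type*} : Measurable (ang (I := I)) :=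
  measurable_pi_lambda _ fun i => AddCircle.measurable_mk'.comp (measurable_pi_apply i)

lemma measurable_angRep {I : Type*} : Measurable (angRep (I := I)) :=
  measurable_pi_lambda _ fun i => measurable_subtype_coe.comp
    ((AddCircle.measurableEquivIco (2 * Real.pi) 0).measurable.comp (measurable_pi_apply i))

/-- Each angle contributes a factor `2π`, the ratio of Lebesgue measure to normalised Haar measure
on the circle. -/
lemma measurePreserving_ang : MeasurePreserving (ang (I := I))
    (volume.restrict (Set.univ.pi fun _ : I => Set.Ico 0 (2 * Real.pi)))
    (ENNReal.ofReal (2 * Real.pi) ^ Fintype.card I • rotorMeasure I) := by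
  refine ⟨measurable_ang, ?_⟩
  have h1 : (volume.restrict (Set.Ico 0 (2 * Real.pi))).map (fun r : ℝ => (r : U1)) =
      (volume : Measure U1) := by
    rw [Measure.restrict_congr_set Ico_ae_eq_Ioc]
    simpa using (AddCircle.measurePreserving_mk (2 * Real.pi) 0).map_eq
  have h2 : Measure.pi (fun _ : I => (volume : Measure U1)) =
      ENNReal.ofReal (2 * Real.pi) ^ Fintype.card I • rotorMeasure I := by
    refine Measure.pi_eq fun s _ => ?_
    rw [rotorMeasure, Measure.infinitePi_eq_pi, Measure.smul_apply, Measure.pi_pi]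
    simp only [AddCircle.volume_eq_smul_haarAddCircle, Measure.smul_apply, smul_eq_mul]
    rw [Finset.prod_mul_distrib, Finset.prod_const, Finset.card_univ]
  rw [volume_pi, Measure.restrict_pi_pi, ← h2]
  refine (Measure.pi_map_pi (f := fun (_ : I) (r : ℝ) => (r : U1))
    fun i => AddCircle.measurable_mk'.aemeasurable).trans ?_
  rw [h1]

lemma ae_angRep_ang :
    ∀ᵐ lam ∂volume.restrict (Set.univ.pi fun _ : I => Set.Ico 0 (2 * Real.pi)),
      angRep (ang lam) = lam := by
  filter_upwards [ae_restrict_mem (MeasurableSet.univ_pi fun _ => measurableSet_Ico)] with lam h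
  exact angRep_ang fun i => h i trivial

lemma measurePreserving_angRep : MeasurePreserving (angRep (I := I))
    (ENNReal.ofReal (2 * Real.pi) ^ Fintype.card I • rotorMeasure I)
    (volume.restrict (Set.univ.pi fun _ : I => Set.Ico 0 (2 * Real.pi))) := by
  refine ⟨measurable_angRep, ?_⟩
  rw [← measurePreserving_ang.map_eq, Measure.map_map measurable_angRep measurable_ang,
    Measure.map_congr (f := angRep ∘ ang) (g := id) ae_angRep_ang, Measure.map_id]

variable (I) in
/-- The normalisation `(2π)^{-|I|/2}`. -/
def angNorm : ℝ := (2 * Real.pi) ^ (-(Fintype.card I : ℝ) / 2)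

lemma angNorm_pos : 0 < angNorm I := Real.rpow_pos_of_pos Real.two_pi_pos _

lemma angNorm_mul_self : angNorm I * angNorm I * (2 * Real.pi) ^ Fintype.card I = 1 := by
  rw [angNorm, ← Real.rpow_add Real.two_pi_pos, ← Real.rpow_natCast,
    ← Real.rpow_add Real.two_pi_pos]
  ring_nf
  exact Real.rpow_zero _

lemma memLp_comp_ang (b : RotorSpace I) : MemLp (fun lam => (angNorm I : ℂ) * b (ang lam)) 2
    (volume.restrict (Set.univ.pi fun _ : I => Set.Ico 0 (2 * Real.pi))) := by
  have h : MemLp b 2 (ENNReal.ofReal (2 * Real.pi) ^ Fintype.card I • rotorMeasure I) :=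
    (Lp.memLp b).smul_measure (ENNReal.pow_ne_top ENNReal.ofReal_ne_top)
  exact (h.comp_measurePreserving measurePreserving_ang).const_mul _

lemma ae_ang {p : (I → U1) → Prop} (h : ∀ᵐ x ∂rotorMeasure I, p x) :
    ∀ᵐ lam ∂volume.restrict (Set.univ.pi fun _ : I => Set.Ico 0 (2 * Real.pi)), p (ang lam) :=
  measurePreserving_ang.quasiMeasurePreserving.ae (Measure.ae_smul_measure h _)

/-- Wave functions as functions of the angles in `[0, 2π)`. -/
def angLin : RotorSpace I →ₗ[ℂ]
    Lp ℂ 2 (volume.restrict (Set.univ.pi fun _ : I => Set.Ico 0 (2 * Real.pi))) where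
  toFun b := (memLp_comp_ang b).toLp _
  map_add' b b' := Lp.ext <| by
    filter_upwards [MemLp.coeFn_toLp (memLp_comp_ang (b + b')), MemLp.coeFn_toLp (memLp_comp_ang b),
      MemLp.coeFn_toLp (memLp_comp_ang b'),
      Lp.coeFn_add ((memLp_comp_ang b).toLp _) ((memLp_comp_ang b').toLp _),
      ae_ang (Lp.coeFn_add b b')] with lam h1 h2 h3 h4 h5
    rw [h1, h4, Pi.add_apply, h2, h3, h5, Pi.add_apply, mul_add]
  map_smul' c b := Lp.ext <| by
    filter_upwards [MemLp.coeFn_toLp (memLp_comp_ang (c • b)), MemLp.coeFn_toLp (memLp_comp_ang b),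
      Lp.coeFn_smul c ((memLp_comp_ang b).toLp _), ae_ang (Lp.coeFn_smul c b)] with lam h1 h2 h3 h4
    rw [h1, RingHom.id_apply, h3, Pi.smul_apply, h2, h4, Pi.smul_apply, mul_smul_comm]

lemma coeFn_angLin (b : RotorSpace I) : angLin b
    =ᵐ[volume.restrict (Set.univ.pi fun _ : I => Set.Ico 0 (2 * Real.pi))]
      fun lam => (angNorm I : ℂ) * b (ang lam) :=
  MemLp.coeFn_toLp (memLp_comp_ang b)

lemma inner_angLin (b b' : RotorSpace I) : inner ℂ (angLin b) (angLin b') = inner ℂ b b' := by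
  have h : (fun lam => inner ℂ (angLin b lam) (angLin b' lam))
      =ᵐ[volume.restrict (Set.univ.pi fun _ : I => Set.Ico 0 (2 * Real.pi))]
        fun lam => ((angNorm I * angNorm I : ℝ) : ℂ) * inner ℂ (b (ang lam)) (b' (ang lam)) := by
    filter_upwards [coeFn_angLin b, coeFn_angLin b'] with lam h h'
    rw [h, h', RCLike.inner_apply, RCLike.inner_apply, map_mul, Complex.conj_ofReal]
    push_cast
    ring
  have hm : AEStronglyMeasurable (fun x => inner ℂ (b x) (b' x))
      ((volume.restrict (Set.univ.pi fun _ : I => Set.Ico 0 (2 * Real.pi))).map ang) := by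
    rw [measurePreserving_ang.map_eq]
    exact (L2.integrable_inner (𝕜 := ℂ) b b').aestronglyMeasurable.smul_measure _
  rw [L2.inner_def, integral_congr_ae h, integral_const_mul,
    ← integral_map measurable_ang.aemeasurable hm, measurePreserving_ang.map_eq,
    integral_smul_measure, ← L2.inner_def, ENNReal.toReal_pow,
    ENNReal.toReal_ofReal Real.two_pi_pos.le, Complex.real_smul, ← mul_assoc, ← Complex.ofReal_mul,
    angNorm_mul_self, Complex.ofReal_one, one_mul]

lemma angLin_surjective : Function.Surjective (angLin (I := I)) := by
  intro a
  have hc : ENNReal.ofReal (2 * Real.pi) ^ Fintype.card I ≠ 0 :=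
    pow_ne_zero _ (ENNReal.ofReal_pos.mpr Real.two_pi_pos).ne'
  have h1 : MemLp (fun x => (angNorm I : ℂ)⁻¹ * a (angRep x)) 2
      (ENNReal.ofReal (2 * Real.pi) ^ Fintype.card I • rotorMeasure I) :=
    ((Lp.memLp a).comp_measurePreserving measurePreserving_angRep).const_mul _
  have h2 : MemLp (fun x => (angNorm I : ℂ)⁻¹ * a (angRep x)) 2 (rotorMeasure I) := by
    -- Rescaling the measure by the inverse constant returns to the normalised one.
    have := h1.smul_measure (c := (ENNReal.ofReal (2 * Real.pi) ^ Fintype.card I)⁻¹) (ENNReal.inv_ne_top.mpr hc)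
    rwa [smul_smul, ENNReal.inv_mul_cancel hc (ENNReal.pow_ne_top ENNReal.ofReal_ne_top), one_smul] at this
  refine ⟨h2.toLp _, Lp.ext ?_⟩
  filter_upwards [coeFn_angLin (h2.toLp _), ae_ang (MemLp.coeFn_toLp h2), ae_angRep_ang]
    with lam e1 e2 e3
  rw [e1, e2, e3, mul_inv_cancel_left₀]
  exact_mod_cast angNorm_pos.ne'

/-- The superposition map is the inverse of the unitary `angLin`; moving it to the other side of the
inner product gives the defining integral. -/
lemma formalOrthonormalBasis_ang : FormalOrthonormalBasis
    (volume.restrict (Set.univ.pi fun _ : I => Set.Ico 0 (2 * Real.pi)))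
    fun lam : I → ℝ => (angNorm I : ℂ) • posKet (ang lam) := by
  let J := LinearIsometryEquiv.ofSurjective (angLin.isometryOfInner (inner_angLin (I := I)))
    angLin_surjective
  refine ⟨J.symm, fun a f => ?_⟩
  have h : (fun lam => inner ℂ (angLin (testVec f) lam) (a lam))
      =ᵐ[volume.restrict (Set.univ.pi fun _ : I => Set.Ico 0 (2 * Real.pi))]
        fun lam => a lam * ((angNorm I : ℂ) • posKet (ang lam) : GenState (I → U1)) f := by
    filter_upwards [coeFn_angLin (testVec f), ae_ang (coeFn_testVec f)] with lam h1 h2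
    rw [h1, h2, RCLike.inner_apply, map_mul, Complex.conj_ofReal]
    rfl
  refine ⟨(L2.integrable_inner (𝕜 := ℂ) (angLin (testVec f)) a).congr h, ?_⟩
  rw [← integral_congr_ae h, ← L2.inner_def, ← J.inner_map_map, J.apply_symm_apply]
  rfl

end

end LatticeQED

end

/-! ### Assembly of the theorem -/

theorem mainTheorem4 {V L : Type*} [Countable L] (Γ : LatticeQED.LinkLattice V L)
    (hΓ : Γ.gaussSum Set.univ = 0) (T : Set L) (hT : Γ.IsSpanningTree T) :
    -- `G(λ) = ∏_v e^{iλ_v C_v}`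
    (∀ lam : V → ℝ, LatticeQED.IsExpProd (fun v => (lam v : ℂ) • Γ.gauss v) (Γ.gauge lam)) ∧
    -- the three spaces are the tensor products of the rotor spaces on the links
    LatticeQED.IsRotorTensorProduct L ∧ LatticeQED.IsRotorTensorProduct T ∧
    LatticeQED.IsRotorTensorProduct (Tᶜ : Set L) ∧
    ∃ (Φ : LatticeQED.HilbertTensor T (Tᶜ : Set L) ≃ₗᵢ[ℂ] LatticeQED.RotorSpace L)
      (W : T → Set V)
      (G' : (T → LatticeQED.U1) → (LatticeQED.RotorSpace L ≃ₗᵢ[ℂ] LatticeQED.RotorSpace L))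
      (G'R : (T → LatticeQED.U1) → (LatticeQED.RotorSpace T ≃ₗᵢ[ℂ] LatticeQED.RotorSpace T))
      (G'S : (T → LatticeQED.U1) →
        (LatticeQED.RotorSpace (Tᶜ : Set L) ≃ₗᵢ[ℂ] LatticeQED.RotorSpace (Tᶜ : Set L))),
      -- 1. `H_kin = H_R ⊗ H_S` and `G(λ) = G_R(λ) ⊗ G_S(λ)`
      (∀ f g, (Φ (LatticeQED.pureTensor f g) : (L → LatticeQED.U1) → ℂ)
        =ᵐ[LatticeQED.rotorMeasure L] fun x => f (fun l => x l) * g (fun l => x l)) ∧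
      (∀ (lam : V → ℝ) f g, Γ.gauge lam (Φ (LatticeQED.pureTensor f g)) =
        Φ (LatticeQED.pureTensor ((Γ.restrict T).gauge lam f) ((Γ.restrict Tᶜ).gauge lam g))) ∧
      -- 2. the constraints `C_{V_l}`, `l ∈ R`, satisfy `C_{V_l,R} = -ε_l`
      (∀ l : T, (Γ.restrict T).gaussSum (W l) = -LatticeQED.elec l) ∧
      -- `G'(λ) = ∏_{l ∈ R} e^{iλ_l C_{V_l}} = G'_R(λ) ⊗ G'_S(λ)`
      (∀ lam : T → ℝ, LatticeQED.IsExpProd (fun l => (lam l : ℂ) • Γ.gaussSum (W l))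
        (G' (LatticeQED.ang lam))) ∧
      (∀ lam : T → ℝ, LatticeQED.IsExpProd
        (fun l => (lam l : ℂ) • (Γ.restrict T).gaussSum (W l)) (G'R (LatticeQED.ang lam))) ∧
      (∀ lam : T → ℝ, LatticeQED.IsExpProd
        (fun l => (lam l : ℂ) • (Γ.restrict Tᶜ).gaussSum (W l)) (G'S (LatticeQED.ang lam))) ∧
      (∀ a f g, G' a (Φ (LatticeQED.pureTensor f g)) =
        Φ (LatticeQED.pureTensor (G'R a f) (G'S a g))) ∧
      -- `G'_R(λ) = ⨂_{l ∈ R} X_l(λ_l)`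
      (∀ lam : T → ℝ, G'R (LatticeQED.ang lam) = LatticeQED.tensorX lam) ∧
      -- `λ ∈ [0, 2π)^R` parametrises the gauge transformations uniquely, `G'` is a strongly
      -- continuous homomorphism, and `G'_R`, `G'_S` are the actions of `𝒢` on `R` and `S`
      Set.BijOn (fun lam : T → ℝ => G' (LatticeQED.ang lam))
        {lam | ∀ l, lam l ∈ Set.Ico 0 (2 * Real.pi)} Γ.gaugeGroup ∧
      (∀ a b, G' (a + b) = G' a * G' b) ∧
      (∀ ψ, Continuous fun a => G' a ψ) ∧
      (∀ (a : T → LatticeQED.U1) (lam : V → ℝ), G' a = Γ.gauge lam →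
        G'R a = (Γ.restrict T).gauge lam ∧ G'S a = (Γ.restrict Tᶜ).gauge lam) ∧
      -- 3. the orientation states `φ(λ) = G'_R(λ) (⨂_l |e^{i0}⟩) = ⨂_l |e^{iλ_l}⟩`
      (∀ lam : T → ℝ, LatticeQED.Applies (G'R (LatticeQED.ang lam)) (LatticeQED.posKet 0)
        (LatticeQED.posKet (LatticeQED.ang lam))) ∧
      (∀ lam : T → ℝ, LatticeQED.IsTensorState (fun l => LatticeQED.posKet (lam l : LatticeQED.U1))
        (LatticeQED.posKet (LatticeQED.ang lam))) ∧
      -- `G'_R(η) φ(λ) = φ(λ + η)`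
      (∀ eta lam : T → ℝ, LatticeQED.Applies (G'R (LatticeQED.ang eta))
        (LatticeQED.posKet (LatticeQED.ang lam)) (LatticeQED.posKet (LatticeQED.ang (lam + eta)))) ∧
      -- formal orthonormal basis, for `∏_l dλ_l/2π`, and for finite `R` also for `∏_l dλ_l`
      LatticeQED.FormalOrthonormalBasis (LatticeQED.rotorMeasure T)
        (fun a : T → LatticeQED.U1 => LatticeQED.posKet a) ∧
      (∀ _ : Fintype T, LatticeQED.FormalOrthonormalBasis
        (MeasureTheory.volume.restrict (Set.univ.pi fun _ : T => Set.Ico 0 (2 * Real.pi)))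
        (fun lam : T → ℝ => (((2 * Real.pi) ^ (-(Fintype.card T : ℝ) / 2) : ℝ) : ℂ) •
          LatticeQED.posKet (LatticeQED.ang lam))) ∧
      -- `R` is a complete ideal quantum reference frame
      LatticeQED.IsIdealQRF (LatticeQED.rotorMeasure T) G'R
        (fun a : T → LatticeQED.U1 => LatticeQED.posKet a) ∧
      LatticeQED.IsCompleteFrame G'R (fun a : T → LatticeQED.U1 => LatticeQED.posKet a) := by 
  classical
  have hfin : ∀ l, (Function.support fun e : T => Γ.coeff (Γ.cut T e) l).Finite :=
    hT.finite_coeff_cut hΓ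
  have hcut : ∀ e l : T, Γ.coeff (Γ.cut T e) l = if l = e then -1 else 0 := fun e l => by
    simp only [hT.coeff_cut e.2 l.2, Subtype.ext_iff]
  refine ⟨Γ.isExpProd_gauge, LatticeQED.isRotorTensorProduct L, LatticeQED.isRotorTensorProduct T,
    LatticeQED.isRotorTensorProduct (Tᶜ : Set L), LatticeQED.splitEquiv T, fun e => Γ.cut T e,
    fun a => LatticeQED.shift (Γ.treeAngle T a), LatticeQED.shift,
    fun a => LatticeQED.shift fun l => Γ.treeAngle T a l,
    ?_, ?_, ?_, ?_, ?_, ?_, ?_, ?_, hT.bijOn_gaugeGroup hΓ, ?_, ?_, ?_, ?_, ?_, ?_, ?_, ?_, ?_, ?_⟩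
  · intro f g
    rw [LatticeQED.splitEquiv_pureTensor]
    exact LatticeQED.coeFn_splitProd T f g
  · intro lam f g
    simp only [LatticeQED.LinkLattice.gauge_eq_shift, LatticeQED.shift_splitEquiv_pureTensor]
    rfl
  · intro l
    refine ((Γ.restrict T).isDiag_gaussSum _).ext ?_
    convert (LatticeQED.isDiag_elec l).neg using 2 with i
    rw [LatticeQED.LinkLattice.coeff_restrict, hcut, Pi.single_apply]
    split_ifs <;> simp
  · intro lam
    exact Γ.isExpProd_shift_coeff _ lam hfin fun e => Γ.isDiag_gaussSum _
  · intro lam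
    have h := (Γ.restrict T).isExpProd_shift_coeff _ lam (fun l => hfin l)
      fun e => (Γ.restrict T).isDiag_gaussSum _
    -- On tree links `treeAngle` returns the given angles, so the product on `R` is the plain
    -- translation.
    convert h using 2
    exact funext fun l => (hT.treeAngle_coe _ l).symm
  · intro lam
    exact (Γ.restrict Tᶜ).isExpProd_shift_coeff _ lam (fun l => hfin l)
      fun e => (Γ.restrict Tᶜ).isDiag_gaussSum _
  · intro a f g
    rw [LatticeQED.shift_splitEquiv_pureTensor]
    simp only [hT.treeAngle_coe]
  · exact fun _ => rfl
  · intro a b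
    simp only [hT.treeAngle_add hΓ, LatticeQED.shift_add]
  · exact fun ψ => (LatticeQED.continuous_shift_apply ψ).comp (hT.continuous_treeAngle hΓ)
  · intro a lam h
    rw [Γ.gauge_eq_shift] at h
    -- Equal translations have equal angles on every link, hence also equal restrictions to `T` and
    -- to its complement.
    have h' := LatticeQED.shift_injective L h
    simp only [LatticeQED.LinkLattice.gauge_eq_shift]
    refine ⟨congrArg _ (funext fun l => ?_), congrArg _ (funext fun l => congrFun h' l)⟩
    rw [← hT.treeAngle_coe a l, h']
    rfl
  · intro lam
    simpa using LatticeQED.applies_shift_posKet (LatticeQED.ang lam) 0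
  · exact fun lam => LatticeQED.isTensorState_posKet (LatticeQED.ang lam)
  · intro eta lam
    have h := LatticeQED.applies_shift_posKet (LatticeQED.ang eta) (LatticeQED.ang lam)
    rwa [add_comm] at h
  · exact LatticeQED.formalOrthonormalBasis_posKet
  · exact fun _ => LatticeQED.formalOrthonormalBasis_ang
  · exact LatticeQED.isIdealQRF_shift
  · exact LatticeQED.isCompleteFrame_shift
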